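/- Let $k$ be a field, $G$ a group, $A=\bigoplus_{g\in G}A_g$ a finite dimensional strongly $G$-graded $k$-algebra ($A_gA_h=A_{gh}$ for all $g,h\in G$), and $B=A_1$. Let $Y$ be a finitely generated left $B$-module, let $\mathrm D=\mathrm{Hom}_k(-,k)$ be the $k$-dual, and for $R\in\{A,B\}$ let $\nu_R=\mathrm D\,\mathrm{Hom}_R(-,R)$ be the Nakayama functor. Gradings: $A\otimes_BY$ has components $A_g\otimes_BY$; for a right $B$-module $N$, $N\otimes_BA$ has components $N\otimes_BA_g$; for a $G$-graded $k$-space $X$, $(\mathrm DX)_g=\{f\mid f(X_h)=0\text{ for all }h\ne g^{-1}\}$; for a $G$-graded left $A$-module $X$, $\mathrm{Hom}_A(X,A)_g=\{f\mid f(X_h)\subseteq A_{hg}\text{ for all }h\in G\}$. Module structures on duals: $(fa)(x)=f(ax)$ on $\mathrm DX$ for a left module $X$, $(af)(x)=f(xa)$ on $\mathrm DX$ for a right module $X$, and $(fa)(x)=f(x)a$ on $\mathrm{Hom}_R(X,R)$. For a finitely generated left $R$-module $X$ and a minimal projective presentation $P_1\xrightarrow{f}P_0\to X\to 0$, put $\mathrm{Tr}_RX=\mathrm{Coker}\big(f^*\colon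 \mathrm{Hom}_R(P_0,R)\to\mathrm{Hom}_R(P_1,R)\big)$ and $\tau_RX=\mathrm D\,\mathrm{Tr}_RX$. If $R=A$, $X$ is $G$-graded, and the presentation is graded ($P_1,P_0$ are $G$-graded $A$-modules and the maps preserve degrees), then $\mathrm{Tr}_AX$ carries the grading induced from $\mathrm{Hom}_A(P_1,A)$, and $\tau_AX$ the dual grading. Then, where in each case both sides are $G$-graded modules: 1) $\mathrm D(A\otimes_BY)\simeq \mathrm DY\otimes_BA$ as $G$-graded right $A$-modules. 2) $\mathrm{Hom}_A(A\otimes_BY,A)\simeq\mathrm{Hom}_B(Y,B)\otimes_BA$ as $G$-graded right $A$-modules. 3) $\nu_A(A\otimes_BY)\simeq A\otimes_B\nu_B(Y)$ as $G$-graded left $A$-modules. Assume moreover that $B$ is self-injective. Then $Y$ has a minimal projective presentation, $A\otimes_BY$ has a graded minimal projective presentation, and: 4) $\mathrm{Tr}_A(A\otimes_BY)\simeq\mathrm{Tr}_BY\otimes_BA$ as right $A$-modules, whichever minimal projective presentations of $Y$ and of $A\otimes_BY$ are used to compute the two sides, and as $G$-graded right $A$-modules whenever the presentation of $A\otimes_BY$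 is graded. 5) $\tau_A(A\otimes_BY)\simeq A\otimes_B\tau_B(Y)$ as left $A$-modules, whichever minimal projective presentations of $Y$ and of $A\otimes_BY$ are used, and as $G$-graded left $A$-modules whenever the presentation of $A\otimes_BY$ is graded. -/

import Mathlib

open scoped TensorProduct

universe u v w w₁ w₂

namespace StronglyGradedInd

section Grading

variable {k : Type*} [Field k] {G : Type*} [Group G] {A : Type*} [Ring A] [Algebra k A]

/-- The `k`-subspaces `A_g` of the `k`-algebra `A` form a strong `G`-grading with `1`-component `B`:
`A` is their (internal) direct sum, `A_g A_h = A_{gh}` (with equality) for all `g, h`, and `A_1 = B`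
(in particular `1 ∈ A_1`). -/
structure IsStronglyGraded (𝒜 : G → Submodule k A) (B : Subalgebra k A) : Prop where
  indep : iSupIndep 𝒜
  iSup_eq_top : ⨆ g, 𝒜 g = ⊤
  mul_eq : ∀ g h : G, 𝒜 g * 𝒜 h = 𝒜 (g * h)
  one_component : 𝒜 1 = Subalgebra.toSubmodule B

/-- `X = ⨁ X_g` is a `G`-graded left `A`-module: internal direct sum with `A_g X_h ⊆ X_{gh}`. -/
structure IsGradedLeft (𝒜 : G → Submodule k A) {X : Type*} [AddCommGroup X] [Module k X]
    [Module A X] (𝒳 : G → Submodule k X) : Prop where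
  indep : iSupIndep 𝒳
  iSup_eq_top : ⨆ g, 𝒳 g = ⊤
  smul_mem : ∀ (g h : G) (a : A) (x : X), a ∈ 𝒜 g → x ∈ 𝒳 h → a • x ∈ 𝒳 (g * h)

/-- `X = ⨁ X_g` is a `G`-graded right `A`-module: internal direct sum with `X_h A_g ⊆ X_{hg}`.
A right `A`-module is a module over `Aᵐᵒᵖ`, and `x a = MulOpposite.op a • x`. -/
structure IsGradedRight (𝒜 : G → Submodule k A) {X : Type*} [AddCommGroup X] [Module k X]
    [Module Aᵐᵒᵖ X] (𝒳 : G → Submodule k X) : Prop where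
  indep : iSupIndep 𝒳
  iSup_eq_top : ⨆ g, 𝒳 g = ⊤
  smul_mem : ∀ (g h : G) (a : A) (x : X), a ∈ 𝒜 g → x ∈ 𝒳 h →
    MulOpposite.op a • x ∈ 𝒳 (h * g)

/-- `X` and `Z` are `G`-graded left `A`-modules, and they are isomorphic as such: there is an
`A`-linear bijection that maps `X_g` onto `Z_g` for every `g`. -/
def GradedIsoLeft (𝒜 : G → Submodule k A) {X Z : Type*}
    [AddCommGroup X] [Module k X] [Module A X] [AddCommGroup Z] [Module k Z] [Module A Z]
    (𝒳 : G → Submodule k X) (𝒵 : G → Submodule k Z) : Prop :=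
  IsGradedLeft 𝒜 𝒳 ∧ IsGradedLeft 𝒜 𝒵 ∧
    ∃ e : X ≃ₗ[A] Z, ∀ (g : G) (x : X), x ∈ 𝒳 g ↔ e x ∈ 𝒵 g

/-- `X` and `Z` are `G`-graded right `A`-modules, and they are isomorphic as such: there is an
`A`-linear bijection that maps `X_g` onto `Z_g` for every `g`. -/
def GradedIsoRight (𝒜 : G → Submodule k A) {X Z : Type*}
    [AddCommGroup X] [Module k X] [Module Aᵐᵒᵖ X] [AddCommGroup Z] [Module k Z] [Module Aᵐᵒᵖ Z]
    (𝒳 : G → Submodule k X) (𝒵 : G → Submodule k Z) : Prop :=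
  IsGradedRight 𝒜 𝒳 ∧ IsGradedRight 𝒜 𝒵 ∧
    ∃ e : X ≃ₗ[Aᵐᵒᵖ] Z, ∀ (g : G) (x : X), x ∈ 𝒳 g ↔ e x ∈ 𝒵 g

end Grading

section KDual

/-- The `k`-dual `D M = Hom_k(M, k)`, as a type of its own so that it can carry the contragredient
module structures. -/
def KDual (k : Type*) [Field k] (M : Type*) [AddCommGroup M] [Module k M] : Type _ :=
  M →ₗ[k] k

variable {k : Type*} [Field k] {M : Type*} [AddCommGroup M] [Module k M]

instance : AddCommGroup (KDual k M) := inferInstanceAs (AddCommGroup (M →ₗ[k] k))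

instance : Module k (KDual k M) := inferInstanceAs (Module k (M →ₗ[k] k))

instance : FunLike (KDual k M) M k := inferInstanceAs (FunLike (M →ₗ[k] k) M k)

/-- For a left `R`-module `M`, the dual `D M` is a right `R`-module: `(f r)(x) = f (r x)`. -/
instance KDual.rightModule {R : Type*} [Ring R] [Algebra k R] [Module R M] [IsScalarTower k R M] :
    Module Rᵐᵒᵖ (KDual k M) where
  smul r f := LinearMap.comp (M₂ := M) f (Algebra.lsmul k k M r.unop)
  one_smul f := LinearMap.ext fun x => congrArg f (one_smul R x)
  mul_smul r s f := LinearMap.ext fun x => congrArg f (mul_smul s.unop r.unop x)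
  smul_zero _ := rfl
  smul_add _ _ _ := rfl
  add_smul r s f := LinearMap.ext fun x =>
    (congrArg f (add_smul r.unop s.unop x)).trans (LinearMap.map_add f _ _)
  zero_smul f := LinearMap.ext fun x =>
    (congrArg f (zero_smul R x)).trans (LinearMap.map_zero f)

/-- For a right `R`-module `M`, the dual `D M` is a left `R`-module: `(r f)(x) = f (x r)`. -/
instance KDual.leftModule {R : Type*} [Ring R] [Algebra k R] [Module Rᵐᵒᵖ M]
    [IsScalarTower k Rᵐᵒᵖ M] : Module R (KDual k M) where
  smul r f := LinearMap.comp (M₂ := M) f (Algebra.lsmul k k M (MulOpposite.op r))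
  one_smul f := LinearMap.ext fun x => congrArg f (one_smul Rᵐᵒᵖ x)
  mul_smul r s f := LinearMap.ext fun x =>
    congrArg f (mul_smul (MulOpposite.op s) (MulOpposite.op r) x)
  smul_zero _ := rfl
  smul_add _ _ _ := rfl
  add_smul r s f := LinearMap.ext fun x =>
    (congrArg f (add_smul (MulOpposite.op r) (MulOpposite.op s) x)).trans (LinearMap.map_add f _ _)
  zero_smul f := LinearMap.ext fun x =>
    (congrArg f (zero_smul Rᵐᵒᵖ x)).trans (LinearMap.map_zero f)

theorem KDual.op_smul_apply {R : Type*} [Ring R] [Algebra k R] [Module R M] [IsScalarTower k R M]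
    (r : R) (f : KDual k M) (x : M) : (MulOpposite.op r • f) x = f (r • x) := rfl

theorem KDual.smul_apply {R : Type*} [Ring R] [Algebra k R] [Module Rᵐᵒᵖ M]
    [IsScalarTower k Rᵐᵒᵖ M] (r : R) (f : KDual k M) (x : M) :
    (r • f) x = f (MulOpposite.op r • x) := rfl

instance KDual.right_isScalarTower {R : Type*} [Ring R] [Algebra k R] [Module R M]
    [IsScalarTower k R M] : IsScalarTower k Rᵐᵒᵖ (KDual k M) where
  smul_assoc c r f := LinearMap.ext fun x =>
    (congrArg f (smul_assoc c r.unop x)).trans (LinearMap.map_smul f c _)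

instance KDual.left_isScalarTower {R : Type*} [Ring R] [Algebra k R] [Module Rᵐᵒᵖ M]
    [IsScalarTower k Rᵐᵒᵖ M] : IsScalarTower k R (KDual k M) where
  smul_assoc c r f := LinearMap.ext fun x =>
    (congrArg f (smul_assoc c (MulOpposite.op r) x)).trans (LinearMap.map_smul f c _)

/-- The grading of the dual: `(D X)_g` consists of the functionals that vanish on `X_h` for all
`h ≠ g⁻¹`. -/
def dualGrading {G : Type*} [Group G] (𝒳 : G → Submodule k M) (g : G) :
    Submodule k (KDual k M) where
  carrier := {f | ∀ h, h ≠ g⁻¹ → ∀ x ∈ 𝒳 h, f x = 0}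
  add_mem' {f f'} hf hf' h hh x hx := by
    change f x + f' x = 0
    rw [hf h hh x hx, hf' h hh x hx, add_zero]
  zero_mem' _ _ _ _ := rfl
  smul_mem' c f hf h hh x hx := by
    change c • f x = 0
    rw [hf h hh x hx, smul_zero]

end KDual

section RingDual

/-- The `R`-dual `M^* = Hom_R(M, R)` of a left `R`-module. It is a right `R`-module by
`(f r)(x) = f(x) r` (Mathlib's structure on linear maps into the bimodule `R`). -/
abbrev RDual (R : Type*) [Ring R] (M : Type*) [AddCommGroup M] [Module R M] : Type _ :=
  M →ₗ[R] R

theorem RDual.op_smul_apply {R : Type*} [Ring R] {M : Type*} [AddCommGroup M] [Module R M]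
    (r : R) (f : RDual R M) (x : M) : (MulOpposite.op r • f) x = f x * r := rfl

/-- The grading of `X^* = Hom_A(X, A)`: `f` has degree `g` when `f(X_h) ⊆ A_{hg}` for all `h`. -/
def rdualGrading {k : Type*} [Field k] {G : Type*} [Group G] {A : Type*} [Ring A] [Algebra k A]
    (𝒜 : G → Submodule k A) {X : Type*} [AddCommGroup X] [Module k X] [Module A X]
    (𝒳 : G → Submodule k X) (g : G) : Submodule k (RDual A X) where
  carrier := {f | ∀ h, ∀ x ∈ 𝒳 h, f x ∈ 𝒜 (h * g)}
  add_mem' hf hf' h x hx := (𝒜 (h * g)).add_mem (hf h x hx) (hf' h x hx)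
  zero_mem' h _ _ := (𝒜 (h * g)).zero_mem
  smul_mem' c _ hf h x hx := (𝒜 (h * g)).smul_mem c (hf h x hx)

/-- The dual `f^* : N^* → M^*`, `φ ↦ φ ∘ f`, of `f : M → N`, a map of right `R`-modules. -/
def rdualMap {R : Type*} [Ring R] {M N : Type*} [AddCommGroup M] [Module R M]
    [AddCommGroup N] [Module R N] (f : M →ₗ[R] N) : RDual R N →ₗ[Rᵐᵒᵖ] RDual R M where
  toFun φ := φ.comp f
  map_add' _ _ := rfl
  map_smul' _ _ := rfl

/-- The Nakayama functor on objects: `ν_R M = D Hom_R(M, R)`, a left `R`-module. -/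
abbrev Nakayama (k : Type*) [Field k] (R : Type*) [Ring R] [Algebra k R]
    (M : Type*) [AddCommGroup M] [Module R M] : Type _ :=
  KDual k (RDual R M)

end RingDual

section Induction

variable {k : Type*} [Field k] {A : Type*} [Ring A] [Algebra k A] (B : Subalgebra k A)

/-- The `A`-submodule of `A ⊗_k Y` generated by all `(a b) ⊗ y - a ⊗ (b y)`. -/
def indRel (Y : Type*) [AddCommGroup Y] [Module k Y] [Module B Y] : Submodule A (A ⊗[k] Y) :=
  Submodule.span A
    {t | ∃ (a : A) (b : B) (y : Y), t = (a * (b : A)) ⊗ₜ[k] y - a ⊗ₜ[k] (b • y)}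

/-- The induced left `A`-module `A ⊗_B Y` of a left `B`-module `Y`, as a quotient of `A ⊗_k Y`. -/
abbrev Ind (Y : Type*) [AddCommGroup Y] [Module k Y] [Module B Y] : Type _ :=
  (A ⊗[k] Y) ⧸ indRel B Y

/-- The element `a ⊗ y` of `A ⊗_B Y`. -/
def Ind.tmul {Y : Type*} [AddCommGroup Y] [Module k Y] [Module B Y] (a : A) (y : Y) : Ind B Y :=
  Submodule.Quotient.mk (a ⊗ₜ[k] y)

/-- The grading of `A ⊗_B Y`: the `g`-component is (the image of) `A_g ⊗_B Y`. -/
def indGrading {G : Type*} (𝒜 : G → Submodule k A)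
    (Y : Type*) [AddCommGroup Y] [Module k Y] [Module B Y] (g : G) : Submodule k (Ind B Y) :=
  Submodule.span k {t | ∃ a ∈ 𝒜 g, ∃ y : Y, t = Ind.tmul B a y}

/-- The right `A`-submodule of `N ⊗_k A` generated by all `n ⊗ (b a) - (n b) ⊗ a`. The two factors
of the tensor product over `k` are written in the opposite order: `a ⊗ₜ n` stands for `n ⊗ a`. The
right action of `A` is `(n ⊗ a) c = n ⊗ (a c)`. -/
def rindRel (N : Type*) [AddCommGroup N] [Module k N] [Module Bᵐᵒᵖ N] :
    Submodule Aᵐᵒᵖ (A ⊗[k] N) :=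
  Submodule.span Aᵐᵒᵖ
    {t | ∃ (a : A) (b : B) (n : N), t = ((b : A) * a) ⊗ₜ[k] n - a ⊗ₜ[k] (MulOpposite.op b • n)}

/-- The induced right `A`-module `N ⊗_B A` of a right `B`-module `N`, as a quotient of
`N ⊗_k A`. -/
abbrev RInd (N : Type*) [AddCommGroup N] [Module k N] [Module Bᵐᵒᵖ N] : Type _ :=
  (A ⊗[k] N) ⧸ rindRel B N

/-- The element `n ⊗ a` of `N ⊗_B A`. -/
def RInd.tmul {N : Type*} [AddCommGroup N] [Module k N] [Module Bᵐᵒᵖ N] (n : N) (a : A) :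
    RInd B N :=
  Submodule.Quotient.mk (a ⊗ₜ[k] n)

/-- The grading of `N ⊗_B A`: the `g`-component is (the image of) `N ⊗_B A_g`. -/
def rindGrading {G : Type*} (𝒜 : G → Submodule k A)
    (N : Type*) [AddCommGroup N] [Module k N] [Module Bᵐᵒᵖ N] (g : G) : Submodule k (RInd B N) :=
  Submodule.span k {t | ∃ a ∈ 𝒜 g, ∃ n : N, t = RInd.tmul B n a}

theorem Ind.smul_tmul {Y : Type*} [AddCommGroup Y] [Module k Y] [Module B Y] (c a : A) (y : Y) :
    c • Ind.tmul B a y = Ind.tmul B (c * a) y := rfl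

theorem RInd.op_smul_tmul {N : Type*} [AddCommGroup N] [Module k N] [Module Bᵐᵒᵖ N]
    (n : N) (a c : A) : MulOpposite.op c • RInd.tmul B n a = RInd.tmul B n (a * c) := rfl

end Induction

section Presentation

/-- A submodule `K` is superfluous when `N + K = M` forces `N = M`. A surjection from a projective
module is a projective cover exactly when its kernel is superfluous. -/
def IsSuperfluous {R : Type*} [Ring R] {M : Type*} [AddCommGroup M] [Module R M]
    (K : Submodule R M) : Prop :=
  ∀ N : Submodule R M, N ⊔ K = ⊤ → N = ⊤

/-- A minimal projective presentation `P₁ → P₀ → Y → 0` of a module `Y` over the `k`-algebra `R`, by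
finitely generated modules: it is exact, `p : P₀ → Y` is a projective cover, and so is
`f : P₁ → Ker p`. -/
structure MinProjPres (k : Type*) [Field k] (R : Type*) [Ring R] [Algebra k R]
    (Y : Type*) [AddCommGroup Y] [Module R Y] where
  P₁ : Type w
  P₀ : Type w
  [addCommGroup₁ : AddCommGroup P₁]
  [kModule₁ : Module k P₁]
  [module₁ : Module R P₁]
  [tower₁ : IsScalarTower k R P₁]
  [addCommGroup₀ : AddCommGroup P₀]
  [kModule₀ : Module k P₀]
  [module₀ : Module R P₀]
  [tower₀ : IsScalarTower k R P₀]
  finite₁ : Module.Finite R P₁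
  finite₀ : Module.Finite R P₀
  projective₁ : Module.Projective R P₁
  projective₀ : Module.Projective R P₀
  f : P₁ →ₗ[R] P₀
  p : P₀ →ₗ[R] Y
  surjective : Function.Surjective p
  exact : LinearMap.range f = LinearMap.ker p
  minimal₀ : IsSuperfluous (LinearMap.ker p)
  minimal₁ : IsSuperfluous (LinearMap.ker f)

attribute [instance] MinProjPres.addCommGroup₁ MinProjPres.kModule₁ MinProjPres.module₁
  MinProjPres.tower₁ MinProjPres.addCommGroup₀ MinProjPres.kModule₀ MinProjPres.module₀
  MinProjPres.tower₀

/-- The presentation `Q` of the graded `A`-module `X` becomes a graded one with the given gradings of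
its two projective terms: these are graded `A`-modules, and both maps preserve degrees. -/
structure MinProjPres.IsGraded {k : Type*} [Field k] {G : Type*} [Group G] {A : Type*} [Ring A]
    [Algebra k A] (𝒜 : G → Submodule k A) {X : Type*} [AddCommGroup X] [Module k X] [Module A X]
    (𝒳 : G → Submodule k X) (Q : MinProjPres.{w} k A X)
    (𝒬₁ : G → Submodule k Q.P₁) (𝒬₀ : G → Submodule k Q.P₀) : Prop where
  graded₁ : IsGradedLeft 𝒜 𝒬₁
  graded₀ : IsGradedLeft 𝒜 𝒬₀
  map_f : ∀ g, ∀ x ∈ 𝒬₁ g, Q.f x ∈ 𝒬₀ g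
  map_p : ∀ g, ∀ x ∈ 𝒬₀ g, Q.p x ∈ 𝒳 g

variable {k : Type*} [Field k] {R : Type*} [Ring R] [Algebra k R]
  {Y : Type*} [AddCommGroup Y] [Module R Y]

/-- The transpose `Tr_R Y = Coker(f^* : P₀^* → P₁^*)`, a right `R`-module, computed from a minimal
projective presentation `P₁ → P₀ → Y → 0`. -/
abbrev MinProjPres.Tr (P : MinProjPres.{w} k R Y) : Type _ :=
  RDual R P.P₁ ⧸ LinearMap.range (rdualMap P.f)

/-- The Auslander-Reiten translation `τ_R Y = D Tr_R Y`, a left `R`-module, computed from a minimal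
projective presentation of `Y`. -/
abbrev MinProjPres.tau (P : MinProjPres.{w} k R Y) : Type _ :=
  KDual k P.Tr

/-- The grading of the transpose induced by a grading of `P₁`: the image of the grading of
`P₁^*`. -/
def MinProjPres.trGrading {G : Type*} [Group G] (𝒜 : G → Submodule k R)
    (P : MinProjPres.{w} k R Y) (𝒫₁ : G → Submodule k P.P₁) (g : G) : Submodule k P.Tr :=
  (rdualGrading 𝒜 𝒫₁ g).map ((LinearMap.range (rdualMap P.f)).mkQ.restrictScalars k)

end Presentation

end StronglyGradedInd

/-! In a strongly graded algebra `1 ∈ A_g A_{g⁻¹}`, so for graded modules everything is decided in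
degree `1`: an element `x` of degree `g` is a sum of terms `a (b x)` with `b x` of degree `1`. Hence
a degree-preserving `A`-linear map is an isomorphism once its degree-`1` part is
(`GradedIsoLeft.of_degree_one`, `GradedIsoRight.of_degree_one`).

Every isomorphism out of an induced module is built in this way. A `B`-linear map from `N` into the
degree-`1` part of the target extends to `N ⊗_B A`, and in degree `1` its inverse is restriction
along `1 ⊗ -`, combined with the projection `A → B`. This gives `rind_kdual_iso`, `ind_kdual_iso`,
`rind_rdual_iso` and `rind_coker_iso`; the statement on Nakayama functors is the dual of the third
followed by the second.

For the transpose, `A ⊗_B -` sends a minimal projective presentation of `Y` to one of `A ⊗_B Y`.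
Exactness rests on `Ind.ker_map`. Minimality rests on `Ind.ofSubmodule_superfluous`: each `A_g ⊗ K`
is superfluous already over `B`, and finitely many of them add up to the submodule generated by `1 ⊗
K`. Then `rind_coker_iso` computes the transpose of the induced presentation. An arbitrary
presentation is reached by uniqueness (`MinProjPres.exists_equiv`), in the graded case after
replacing lifts by their degree-`1` components (`MinProjPres.exists_graded_equiv`). Dualizing yields
the statement for `τ`.

Finite sums over `G` are available because a nonzero `A` of finite dimension forces `G` to be
finite. Existence of minimal presentations comes from the Artinian property, through Fitting's lemma
(`exists_projective_cover`). -/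

namespace StronglyGradedInd

/-! ### Internal direct sums and their projections. -/

section Decomp

variable {k : Type*} [Field k] {G : Type*} {X Z : Type*} [AddCommGroup X] [Module k X]
  [AddCommGroup Z] [Module k Z]

/-- `X` is the internal direct sum of the subspaces `𝒳 g`. -/
structure IsDecomp (𝒳 : G → Submodule k X) : Prop where
  indep : iSupIndep 𝒳
  iSup_eq_top : ⨆ g, 𝒳 g = ⊤

namespace IsDecomp

theorem of_subsingleton [Subsingleton X] (𝒳 : G → Submodule k X) : IsDecomp 𝒳 where
  indep _ := by
    rw [Submodule.disjoint_def]
    intro x _ _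
    exact Subsingleton.elim _ _
  iSup_eq_top := Subsingleton.elim _ _

/-- A family of subspaces that span, with projections onto them killing the others, is a
decomposition. -/
theorem of_projections {𝒳 : G → Submodule k X} (htop : ⨆ g, 𝒳 g = ⊤) (π : G → X →ₗ[k] X)
    (hπ : ∀ g, ∀ x ∈ 𝒳 g, π g x = x) (hπ' : ∀ g h, h ≠ g → ∀ x ∈ 𝒳 h, π g x = 0) :
    IsDecomp 𝒳 where
  indep g := by
    rw [Submodule.disjoint_def]
    intro x hx hx'
    rw [← hπ g x hx]
    have : ⨆ j, ⨆ (_ : j ≠ g), 𝒳 j ≤ LinearMap.ker (π g) :=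
      iSup₂_le fun h hh y hy => hπ' g h hh y hy
    exact this hx'
  iSup_eq_top := htop

variable {𝒳 : G → Submodule k X} {𝒵 : G → Submodule k Z}

theorem isCompl (h : IsDecomp 𝒳) (g : G) : IsCompl (𝒳 g) (⨆ j, ⨆ (_ : j ≠ g), 𝒳 j) where
  disjoint := h.indep g
  codisjoint := by
    rw [codisjoint_iff, eq_top_iff, ← h.iSup_eq_top]
    refine iSup_le fun j => ?_
    by_cases hj : j = g
    · subst hj; exact le_sup_left
    · exact le_sup_of_le_right (le_iSup₂_of_le j hj le_rfl)

/-- The projection onto the `g`-component. -/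
noncomputable def proj (h : IsDecomp 𝒳) (g : G) : X →ₗ[k] X :=
  Submodule.projection _ _ (h.isCompl g)

theorem proj_mem (h : IsDecomp 𝒳) (g : G) (x : X) : h.proj g x ∈ 𝒳 g :=
  Submodule.projection_apply_mem _ _

theorem proj_self (h : IsDecomp 𝒳) {g : G} {x : X} (hx : x ∈ 𝒳 g) : h.proj g x = x :=
  Submodule.projection_apply_left (h.isCompl g) ⟨x, hx⟩

theorem proj_of_ne (h : IsDecomp 𝒳) {g j : G} (hj : j ≠ g) {x : X} (hx : x ∈ 𝒳 j) :
    h.proj g x = 0 :=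
  Submodule.projection_apply_right (h.isCompl g)
    ⟨x, (le_iSup₂_of_le (f := fun j (_ : j ≠ g) => 𝒳 j) j hj le_rfl) hx⟩

theorem mem_iff (h : IsDecomp 𝒳) {g : G} {x : X} : x ∈ 𝒳 g ↔ h.proj g x = x :=
  ⟨h.proj_self, fun hx => hx ▸ h.proj_mem g x⟩

theorem induction (h : IsDecomp 𝒳) {C : X → Prop} (hmem : ∀ g, ∀ x ∈ 𝒳 g, C x) (hzero : C 0)
    (hadd : ∀ x y, C x → C y → C (x + y)) (x : X) : C x :=
  Submodule.iSup_induction 𝒳 (motive := C) (h.iSup_eq_top ▸ Submodule.mem_top) hmem hzero hadd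

/-- Linear maps that agree on all components are equal. -/
theorem hom_ext (h : IsDecomp 𝒳) {φ ψ : X →ₗ[k] Z} (hφ : ∀ g, ∀ x ∈ 𝒳 g, φ x = ψ x) : φ = ψ := by
  rw [← LinearMap.eqLocus_eq_top, eq_top_iff, ← h.iSup_eq_top]
  exact iSup_le hφ

/-- Degree-preserving maps commute with the projections. -/
theorem map_proj (h : IsDecomp 𝒳) (h' : IsDecomp 𝒵) {φ : X →ₗ[k] Z}
    (hφ : ∀ g, ∀ x ∈ 𝒳 g, φ x ∈ 𝒵 g) (g : G) (x : X) : φ (h.proj g x) = h'.proj g (φ x) := by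
  refine LinearMap.congr_fun (f := φ ∘ₗ h.proj g) (g := h'.proj g ∘ₗ φ) (h.hom_ext ?_) x
  intro j y hy
  simp only [LinearMap.comp_apply]
  by_cases hj : j = g
  · subst hj; rw [h.proj_self hy, h'.proj_self (hφ j y hy)]
  · rw [h.proj_of_ne hj hy, h'.proj_of_ne hj (hφ j y hy), map_zero]

theorem sum_proj [Fintype G] (h : IsDecomp 𝒳) (x : X) : ∑ g, h.proj g x = x := by
  have : ∑ g, h.proj g = LinearMap.id := by
    refine h.hom_ext fun j y hy => ?_
    rw [LinearMap.sum_apply, Finset.sum_eq_single j]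
    · rw [h.proj_self hy]; rfl
    · intro g _ hg; exact h.proj_of_ne hg.symm hy
    · simp
  rw [← LinearMap.sum_apply, this, LinearMap.id_apply]

theorem eq_zero_of_proj [Finite G] (h : IsDecomp 𝒳) {x : X} (hx : ∀ g, h.proj g x = 0) : x = 0 := by
  cases nonempty_fintype G
  rw [← h.sum_proj x]
  exact Finset.sum_eq_zero fun g _ => hx g

/-- The image of a decomposition in the quotient by a subspace stable under the projections. -/
theorem map_of_surjective (h : IsDecomp 𝒳) (q : X →ₗ[k] Z) (hq : Function.Surjective q)
    (hstable : ∀ g x, q x = 0 → q (h.proj g x) = 0) : IsDecomp fun g => (𝒳 g).map q := by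
  have hex : ∀ g, ∃ π : Z →ₗ[k] Z, ∀ x, π (q x) = q (h.proj g x) := by
    intro g
    -- By stability `q ∘ proj g` factors through `X / ker q`, which `q` identifies with `Z`.
    refine ⟨((LinearMap.ker q).liftQ (q ∘ₗ h.proj g) fun x hx => hstable g x hx) ∘ₗ
      (q.quotKerEquivOfSurjective hq).symm.toLinearMap, fun x => ?_⟩
    have : (q.quotKerEquivOfSurjective hq).symm (q x) = (LinearMap.ker q).mkQ x := by
      rw [LinearEquiv.symm_apply_eq]; rfl
    simp only [LinearMap.comp_apply, LinearEquiv.coe_coe, this]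
    rfl
  choose π hπ using hex
  refine of_projections ?_ π ?_ ?_
  · rw [← Submodule.map_iSup, h.iSup_eq_top, Submodule.map_top, LinearMap.range_eq_top.2 hq]
  · rintro g _ ⟨x, hx, rfl⟩
    rw [hπ, h.proj_self hx]
  · rintro g j hj _ ⟨x, hx, rfl⟩
    rw [hπ, h.proj_of_ne hj hx, map_zero]

/-- The decomposition of the dual space. -/
theorem dual {G : Type*} [Group G] [Finite G] {𝒳 : G → Submodule k X} (h : IsDecomp 𝒳) :
    IsDecomp (dualGrading 𝒳) := by
  cases nonempty_fintype G
  -- A functional of degree `g` lives on the component of degree `g⁻¹`, hence the inverse.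
  let π : G → KDual k X →ₗ[k] KDual k X := fun g =>
    { toFun := fun f => LinearMap.comp (M₂ := X) f (h.proj g⁻¹)
      map_add' := fun _ _ => rfl
      map_smul' := fun _ _ => rfl }
  have hπ : ∀ g (f : KDual k X) x, π g f x = f (h.proj g⁻¹ x) := fun _ _ _ => rfl
  have hext : ∀ f f' : KDual k X, (∀ j, ∀ x ∈ 𝒳 j, f x = f' x) → f = f' :=
    fun f f' H => h.hom_ext (φ := f) (ψ := f') H
  have hmem : ∀ g f, π g f ∈ dualGrading 𝒳 g := by
    intro g f j hj x hx
    rw [hπ, h.proj_of_ne hj hx]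
    exact LinearMap.map_zero f
  have happ : ∀ (f : KDual k X) (x : X), f x = ∑ g, f (h.proj g x) := by
    intro f x
    conv_lhs => rw [← h.sum_proj x]
    exact map_sum (show X →ₗ[k] k from f) _ _
  refine of_projections ?_ π ?_ ?_
  · rw [eq_top_iff]
    rintro f -
    have : f = ∑ g, π g f := by
      refine LinearMap.ext fun x => ?_
      refine (happ f x).trans ?_
      refine Eq.trans ?_ (LinearMap.sum_apply (M := X) (M₂ := k) Finset.univ (fun g => π g f) x).symm
      exact (Equiv.sum_comp (Equiv.inv G) fun g => f (h.proj g x)).symm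
    rw [this]
    exact Submodule.sum_mem _ fun g _ => Submodule.mem_iSup_of_mem g (hmem g f)
  · intro g f hf
    refine hext _ _ fun j x hx => ?_
    rw [hπ]
    by_cases hj : j = g⁻¹
    · subst hj; rw [h.proj_self hx]
    · rw [h.proj_of_ne hj hx, hf j hj x hx]
      exact LinearMap.map_zero f
  · intro g j hj f hf
    exact LinearMap.ext fun x =>
      hf g⁻¹ (fun H => hj (inv_injective H).symm) _ (h.proj_mem _ _)

end IsDecomp

end Decomp

/-! ### Graded modules over a strongly graded algebra. -/

section Graded

variable {k : Type*} [Field k] {G : Type*} [Group G] {A : Type*} [Ring A] [Algebra k A]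
  {𝒜 : G → Submodule k A} {B : Subalgebra k A}
  {X Z : Type*} [AddCommGroup X] [Module k X] [AddCommGroup Z] [Module k Z]
  {𝒳 : G → Submodule k X} {𝒵 : G → Submodule k Z}

theorem IsStronglyGraded.decomp (hA : IsStronglyGraded 𝒜 B) : IsDecomp 𝒜 :=
  ⟨hA.indep, hA.iSup_eq_top⟩

theorem IsStronglyGraded.mul_mem (hA : IsStronglyGraded 𝒜 B) {g h : G} {a b : A} (ha : a ∈ 𝒜 g)
    (hb : b ∈ 𝒜 h) : a * b ∈ 𝒜 (g * h) :=
  hA.mul_eq g h ▸ Submodule.mul_mem_mul ha hb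

theorem IsStronglyGraded.mem_one_iff (hA : IsStronglyGraded 𝒜 B) {a : A} : a ∈ 𝒜 1 ↔ a ∈ B := by
  rw [hA.one_component, Subalgebra.mem_toSubmodule]

theorem IsStronglyGraded.mem_one (hA : IsStronglyGraded 𝒜 B) (b : B) : (b : A) ∈ 𝒜 1 :=
  hA.mem_one_iff.2 b.2

theorem IsStronglyGraded.one_mem (hA : IsStronglyGraded 𝒜 B) : (1 : A) ∈ 𝒜 1 :=
  hA.mem_one_iff.2 B.one_mem

/-- Since `1 ∈ A_g A_{g⁻¹}`, an element `x` of a left module is a sum of elements `a b x`. -/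
theorem IsStronglyGraded.mem_of_smul {X : Type*} [AddCommGroup X] [Module A X]
    (hA : IsStronglyGraded 𝒜 B) (g : G)
    (S : AddSubmonoid X) (x : X) (h : ∀ a ∈ 𝒜 g, ∀ b ∈ 𝒜 g⁻¹, a • b • x ∈ S) : x ∈ S := by
  have h1 : (1 : A) ∈ 𝒜 g * 𝒜 g⁻¹ := by
    rw [hA.mul_eq, mul_inv_cancel]; exact hA.one_mem
  have := Submodule.mul_induction_on (C := fun r => r • x ∈ S) h1
    (fun a ha b hb => by rw [mul_smul]; exact h a ha b hb)
    (fun a b ha hb => by rw [add_smul]; exact S.add_mem ha hb)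
  rwa [one_smul] at this

/-- Writing `1 = ∑ aᵢ bᵢ` gives `x = ∑ (x aᵢ) bᵢ`; on the right it is the factor from `A_g` that
acts first. -/
theorem IsStronglyGraded.mem_of_op_smul {X : Type*} [AddCommGroup X] [Module Aᵐᵒᵖ X]
    (hA : IsStronglyGraded 𝒜 B) (g : G)
    (S : AddSubmonoid X) (x : X)
    (h : ∀ a ∈ 𝒜 g, ∀ b ∈ 𝒜 g⁻¹, MulOpposite.op b • MulOpposite.op a • x ∈ S) : x ∈ S := by
  have h1 : (1 : A) ∈ 𝒜 g * 𝒜 g⁻¹ := by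
    rw [hA.mul_eq, mul_inv_cancel]; exact hA.one_mem
  have := Submodule.mul_induction_on (C := fun r => MulOpposite.op r • x ∈ S) h1
    (fun a ha b hb => by rw [MulOpposite.op_mul, mul_smul]; exact h a ha b hb)
    (fun a b ha hb => by rw [MulOpposite.op_add, add_smul]; exact S.add_mem ha hb)
  rwa [MulOpposite.op_one, one_smul] at this

/-- The projection `A → A_1 = B`. -/
noncomputable def IsStronglyGraded.toBase (hA : IsStronglyGraded 𝒜 B) : A →ₗ[k] B :=
  (hA.decomp.proj 1).codRestrict (Subalgebra.toSubmodule B)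
    fun a => hA.one_component ▸ hA.decomp.proj_mem 1 a

theorem IsStronglyGraded.toBase_coe (hA : IsStronglyGraded 𝒜 B) (b : B) : hA.toBase b = b :=
  Subtype.ext (hA.decomp.proj_self (hA.mem_one b))

theorem IsStronglyGraded.toBase_one (hA : IsStronglyGraded 𝒜 B) : hA.toBase 1 = 1 :=
  hA.toBase_coe 1

theorem IsStronglyGraded.toBase_of_ne (hA : IsStronglyGraded 𝒜 B) {g : G} (hg : g ≠ 1) {a : A}
    (ha : a ∈ 𝒜 g) : hA.toBase a = 0 :=
  Subtype.ext (hA.decomp.proj_of_ne hg ha)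

/-- Multiplication by an element of degree `1` preserves degrees, so it commutes with the
projections. With its left-hand twin this makes `A → B` a map of `B`-bimodules. -/
theorem IsStronglyGraded.proj_mul_coe (hA : IsStronglyGraded 𝒜 B) (g : G) (a : A) (b : B) :
    hA.decomp.proj g (a * b) = hA.decomp.proj g a * b :=
  (hA.decomp.map_proj hA.decomp (φ := LinearMap.mulRight k (b : A))
    (fun j x hx => by simpa using hA.mul_mem hx (hA.mem_one b)) g a).symm

theorem IsStronglyGraded.proj_coe_mul (hA : IsStronglyGraded 𝒜 B) (g : G) (a : A) (b : B) :
    hA.decomp.proj g (b * a) = b * hA.decomp.proj g a :=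
  (hA.decomp.map_proj hA.decomp (φ := LinearMap.mulLeft k (b : A))
    (fun j x hx => by simpa using hA.mul_mem (hA.mem_one b) hx) g a).symm

theorem IsStronglyGraded.toBase_mul_coe (hA : IsStronglyGraded 𝒜 B) (a : A) (b : B) :
    hA.toBase (a * b) = hA.toBase a * b :=
  Subtype.ext (hA.proj_mul_coe 1 a b)

theorem IsStronglyGraded.toBase_coe_mul (hA : IsStronglyGraded 𝒜 B) (a : A) (b : B) :
    hA.toBase (b * a) = b * hA.toBase a :=
  Subtype.ext (hA.proj_coe_mul 1 a b)

section Left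

variable [Module A X] [Module A Z]

theorem IsGradedLeft.decomp (hX : IsGradedLeft 𝒜 𝒳) : IsDecomp 𝒳 := ⟨hX.indep, hX.iSup_eq_top⟩

theorem IsGradedLeft.of_decomp (hX : IsDecomp 𝒳)
    (h : ∀ (g h : G) (a : A) (x : X), a ∈ 𝒜 g → x ∈ 𝒳 h → a • x ∈ 𝒳 (g * h)) :
    IsGradedLeft 𝒜 𝒳 := ⟨hX.indep, hX.iSup_eq_top, h⟩

theorem IsGradedLeft.of_subsingleton [Subsingleton X] (𝒳 : G → Submodule k X) :
    IsGradedLeft 𝒜 𝒳 :=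
  .of_decomp (.of_subsingleton 𝒳) fun g h a x _ _ => by
    rw [Subsingleton.elim (a • x) 0]; exact zero_mem _

theorem GradedIsoLeft.of_subsingleton [Subsingleton A] (𝒳 : G → Submodule k X)
    (𝒵 : G → Submodule k Z) : GradedIsoLeft 𝒜 𝒳 𝒵 := by
  have := Module.subsingleton A X
  have := Module.subsingleton A Z
  refine ⟨.of_subsingleton _, .of_subsingleton _, 0, fun g x => ?_⟩
  rw [Subsingleton.elim x 0, map_zero]
  simp

theorem GradedIsoLeft.trans {W : Type*} [AddCommGroup W] [Module k W] [Module A W]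
    {𝒲 : G → Submodule k W} (h : GradedIsoLeft 𝒜 𝒳 𝒵) (h' : GradedIsoLeft 𝒜 𝒵 𝒲) :
    GradedIsoLeft 𝒜 𝒳 𝒲 := by
  obtain ⟨h₁, -, e, he⟩ := h
  obtain ⟨-, h₂, e', he'⟩ := h'
  exact ⟨h₁, h₂, e.trans e', fun g x => (he g x).trans (he' g _)⟩

theorem GradedIsoLeft.symm (h : GradedIsoLeft 𝒜 𝒳 𝒵) : GradedIsoLeft 𝒜 𝒵 𝒳 := by
  obtain ⟨h₁, h₂, e, he⟩ := h
  exact ⟨h₂, h₁, e.symm, fun g x => by rw [he, e.apply_symm_apply]⟩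

/-- Left translation by `g` is injective on degrees, so only the component `X_h` is carried into
`X_{gh}`. -/
theorem IsGradedLeft.proj_smul [IsScalarTower k A X] (hX : IsGradedLeft 𝒜 𝒳) {g h : G} {a : A}
    (ha : a ∈ 𝒜 g) (x : X) :
    hX.decomp.proj (g * h) (a • x) = a • hX.decomp.proj h x := by
  refine LinearMap.congr_fun (f := hX.decomp.proj (g * h) ∘ₗ Algebra.lsmul k k X a)
    (g := Algebra.lsmul k k X a ∘ₗ hX.decomp.proj h) (hX.decomp.hom_ext ?_) x
  intro j y hy
  simp only [LinearMap.comp_apply, Algebra.lsmul_coe]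
  by_cases hj : j = h
  · subst hj
    rw [hX.decomp.proj_self hy, hX.decomp.proj_self (hX.smul_mem _ _ _ _ ha hy)]
  · rw [hX.decomp.proj_of_ne hj hy, smul_zero,
      hX.decomp.proj_of_ne (fun H => hj (mul_left_cancel H)) (hX.smul_mem _ _ _ _ ha hy)]

/-- A homomorphism of graded modules over a strongly graded algebra is an isomorphism as soon as
its component of degree `1` is. -/
theorem GradedIsoLeft.of_degree_one [Finite G] [IsScalarTower k A X] [IsScalarTower k A Z]
    (hA : IsStronglyGraded 𝒜 B) (hX : IsGradedLeft 𝒜 𝒳) (hZ : IsGradedLeft 𝒜 𝒵) (e : X →ₗ[A] Z)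
    (he : ∀ g, ∀ x ∈ 𝒳 g, e x ∈ 𝒵 g) (hinj : ∀ x ∈ 𝒳 1, e x = 0 → x = 0)
    (hsurj : ∀ z ∈ 𝒵 1, ∃ x, e x = z) : GradedIsoLeft 𝒜 𝒳 𝒵 := by
  have hproj : ∀ g x, e (hX.decomp.proj g x) = hZ.decomp.proj g (e x) := fun g x =>
    hX.decomp.map_proj hZ.decomp (φ := e.restrictScalars k) he g x
  -- If `e x = 0` then each `b x` with `b ∈ A_{g⁻¹}` is a degree-`1` element of the kernel, hence
  -- zero, and `x` is a sum of terms `a (b x)`. Surjectivity below uses the same transfer to degree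
  -- `1`.
  have hinj' : ∀ g, ∀ x ∈ 𝒳 g, e x = 0 → x = 0 := by
    intro g x hx hex
    refine hA.mem_of_smul g ⊥ x fun a _ b hb => ?_
    have h1 : b • x ∈ 𝒳 1 := by simpa using hX.smul_mem _ _ _ _ hb hx
    rw [hinj _ h1 (by rw [map_smul, hex, smul_zero]), smul_zero]
    exact zero_mem _
  have hbij : Function.Bijective e := by
    constructor
    · rw [injective_iff_map_eq_zero]
      intro x hx
      refine hX.decomp.eq_zero_of_proj fun g => hinj' g _ (hX.decomp.proj_mem g x) ?_
      rw [hproj, hx, map_zero]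
    · rw [← LinearMap.range_eq_top, eq_top_iff]
      rintro z -
      have hmem : ∀ g, ∀ z ∈ 𝒵 g, z ∈ LinearMap.range e := by
        intro g z hz
        refine hA.mem_of_smul g (LinearMap.range e).toAddSubmonoid z fun a _ b hb => ?_
        exact (LinearMap.range e).smul_mem a
          (hsurj _ (by simpa using hZ.smul_mem _ _ _ _ hb hz))
      cases nonempty_fintype G
      rw [← hZ.decomp.sum_proj z]
      exact Submodule.sum_mem _ fun g _ => hmem g _ (hZ.decomp.proj_mem g z)
  refine ⟨hX, hZ, LinearEquiv.ofBijective e hbij, fun g x => ⟨he g x, fun hx => ?_⟩⟩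
  -- `x` and its projection to degree `g` have the same image under the injective `e`.
  rw [hX.decomp.mem_iff]
  refine hbij.1 ?_
  rw [hproj]
  exact hZ.decomp.proj_self hx

/-- The dual of a graded left module. -/
theorem IsGradedLeft.dual [Finite G] [IsScalarTower k A X] (hX : IsGradedLeft 𝒜 𝒳) :
    IsGradedRight 𝒜 (dualGrading 𝒳) where
  indep := hX.decomp.dual.indep
  iSup_eq_top := hX.decomp.dual.iSup_eq_top
  smul_mem g h a f ha hf j hj x hx := by
    rw [KDual.op_smul_apply]
    refine hf (g * j) (fun H => hj ?_) _ (hX.smul_mem _ _ _ _ ha hx)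
    rw [mul_inv_rev, ← H, inv_mul_cancel_left]

end Left

section Right

variable [Module Aᵐᵒᵖ X] [Module Aᵐᵒᵖ Z]

theorem IsGradedRight.decomp (hX : IsGradedRight 𝒜 𝒳) : IsDecomp 𝒳 := ⟨hX.indep, hX.iSup_eq_top⟩

theorem IsGradedRight.of_decomp (hX : IsDecomp 𝒳)
    (h : ∀ (g h : G) (a : A) (x : X), a ∈ 𝒜 g → x ∈ 𝒳 h → MulOpposite.op a • x ∈ 𝒳 (h * g)) :
    IsGradedRight 𝒜 𝒳 := ⟨hX.indep, hX.iSup_eq_top, h⟩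

theorem IsGradedRight.of_subsingleton [Subsingleton X] (𝒳 : G → Submodule k X) :
    IsGradedRight 𝒜 𝒳 :=
  .of_decomp (.of_subsingleton 𝒳) fun g h a x _ _ => by
    rw [Subsingleton.elim (MulOpposite.op a • x) 0]; exact zero_mem _

theorem GradedIsoRight.of_subsingleton [Subsingleton A] (𝒳 : G → Submodule k X)
    (𝒵 : G → Submodule k Z) : GradedIsoRight 𝒜 𝒳 𝒵 := by
  have := Module.subsingleton Aᵐᵒᵖ X
  have := Module.subsingleton Aᵐᵒᵖ Z
  refine ⟨.of_subsingleton _, .of_subsingleton _, 0, fun g x => ?_⟩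
  rw [Subsingleton.elim x 0, map_zero]
  simp

theorem GradedIsoRight.trans {W : Type*} [AddCommGroup W] [Module k W] [Module Aᵐᵒᵖ W]
    {𝒲 : G → Submodule k W} (h : GradedIsoRight 𝒜 𝒳 𝒵) (h' : GradedIsoRight 𝒜 𝒵 𝒲) :
    GradedIsoRight 𝒜 𝒳 𝒲 := by
  obtain ⟨h₁, -, e, he⟩ := h
  obtain ⟨-, h₂, e', he'⟩ := h'
  exact ⟨h₁, h₂, e.trans e', fun g x => (he g x).trans (he' g _)⟩

theorem GradedIsoRight.symm (h : GradedIsoRight 𝒜 𝒳 𝒵) : GradedIsoRight 𝒜 𝒵 𝒳 := by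
  obtain ⟨h₁, h₂, e, he⟩ := h
  exact ⟨h₂, h₁, e.symm, fun g x => by rw [he, e.apply_symm_apply]⟩

/-- A homomorphism of graded modules over a strongly graded algebra is an isomorphism as soon as
its component of degree `1` is. -/
theorem GradedIsoRight.of_degree_one [Finite G] [IsScalarTower k Aᵐᵒᵖ X] [IsScalarTower k Aᵐᵒᵖ Z]
    (hA : IsStronglyGraded 𝒜 B) (hX : IsGradedRight 𝒜 𝒳) (hZ : IsGradedRight 𝒜 𝒵)
    (e : X →ₗ[Aᵐᵒᵖ] Z) (he : ∀ g, ∀ x ∈ 𝒳 g, e x ∈ 𝒵 g) (hinj : ∀ x ∈ 𝒳 1, e x = 0 → x = 0)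
    (hsurj : ∀ z ∈ 𝒵 1, ∃ x, e x = z) : GradedIsoRight 𝒜 𝒳 𝒵 := by
  have hproj : ∀ g x, e (hX.decomp.proj g x) = hZ.decomp.proj g (e x) := fun g x =>
    hX.decomp.map_proj hZ.decomp (φ := e.restrictScalars k) he g x
  have hinj' : ∀ g, ∀ x ∈ 𝒳 g, e x = 0 → x = 0 := by
    intro g x hx hex
    -- With `a ∈ A_{g⁻¹}` acting first, `x a` has degree `g g⁻¹ = 1`.
    refine hA.mem_of_op_smul g⁻¹ ⊥ x fun a ha b _ => ?_
    have h1 : MulOpposite.op a • x ∈ 𝒳 1 := by simpa using hX.smul_mem _ _ _ _ ha hx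
    rw [hinj _ h1 (by rw [map_smul, hex, smul_zero]), smul_zero]
    exact zero_mem _
  have hbij : Function.Bijective e := by
    constructor
    · rw [injective_iff_map_eq_zero]
      intro x hx
      refine hX.decomp.eq_zero_of_proj fun g => hinj' g _ (hX.decomp.proj_mem g x) ?_
      rw [hproj, hx, map_zero]
    · rw [← LinearMap.range_eq_top, eq_top_iff]
      rintro z -
      have hmem : ∀ g, ∀ z ∈ 𝒵 g, z ∈ LinearMap.range e := by
        intro g z hz
        refine hA.mem_of_op_smul g⁻¹ (LinearMap.range e).toAddSubmonoid z fun a ha b _ => ?_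
        exact (LinearMap.range e).smul_mem _
          (hsurj _ (by simpa using hZ.smul_mem _ _ _ _ ha hz))
      cases nonempty_fintype G
      rw [← hZ.decomp.sum_proj z]
      exact Submodule.sum_mem _ fun g _ => hmem g _ (hZ.decomp.proj_mem g z)
  refine ⟨hX, hZ, LinearEquiv.ofBijective e hbij, fun g x => ⟨he g x, fun hx => ?_⟩⟩
  rw [hX.decomp.mem_iff]
  refine hbij.1 ?_
  rw [hproj]
  exact hZ.decomp.proj_self hx

/-- The dual of a graded right module. -/
theorem IsGradedRight.dual [Finite G] [IsScalarTower k Aᵐᵒᵖ X] (hX : IsGradedRight 𝒜 𝒳) :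
    IsGradedLeft 𝒜 (dualGrading 𝒳) where
  indep := hX.decomp.dual.indep
  iSup_eq_top := hX.decomp.dual.iSup_eq_top
  smul_mem g h a f ha hf j hj x hx := by
    rw [KDual.smul_apply]
    refine hf (j * g) (fun H => hj ?_) _ (hX.smul_mem _ _ _ _ ha hx)
    rw [mul_inv_rev, ← H, mul_inv_cancel_right]

/-- The dual of an isomorphism of right modules. -/
def kdualEquiv [IsScalarTower k Aᵐᵒᵖ X] [IsScalarTower k Aᵐᵒᵖ Z] (e : X ≃ₗ[Aᵐᵒᵖ] Z) :
    KDual k Z ≃ₗ[A] KDual k X where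
  toFun f := LinearMap.comp (M₂ := Z) f (e.toLinearMap.restrictScalars k)
  map_add' _ _ := rfl
  map_smul' a f := LinearMap.ext fun x => congrArg f (map_smul e (MulOpposite.op a) x).symm
  invFun f := LinearMap.comp (M₂ := X) f (e.symm.toLinearMap.restrictScalars k)
  left_inv f := LinearMap.ext fun x => congrArg f (e.apply_symm_apply x)
  right_inv f := LinearMap.ext fun x => congrArg f (e.symm_apply_apply x)

theorem kdualEquiv_apply [IsScalarTower k Aᵐᵒᵖ X] [IsScalarTower k Aᵐᵒᵖ Z] (e : X ≃ₗ[Aᵐᵒᵖ] Z)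
    (f : KDual k Z) (x : X) : kdualEquiv (k := k) e f x = f (e x) := rfl

theorem GradedIsoRight.dual [Finite G] [IsScalarTower k Aᵐᵒᵖ X] [IsScalarTower k Aᵐᵒᵖ Z]
    (h : GradedIsoRight 𝒜 𝒳 𝒵) : GradedIsoLeft 𝒜 (dualGrading 𝒳) (dualGrading 𝒵) := by
  obtain ⟨hX, hZ, e, he⟩ := h
  refine GradedIsoLeft.symm ⟨hZ.dual, hX.dual, kdualEquiv e, fun g f => ⟨fun hf j hj x hx => ?_,
    fun hf j hj z hz => ?_⟩⟩
  · exact hf j hj _ ((he j x).1 hx)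
  · have := hf j hj (e.symm z) ((he j _).2 (by rwa [e.apply_symm_apply]))
    rwa [kdualEquiv_apply, e.apply_symm_apply] at this

end Right

section HomComponent

variable [Module A X] [Module A Z] [IsScalarTower k A X] [IsScalarTower k A Z]

/-- The component of degree `g` of a homomorphism between graded modules. -/
noncomputable def homComponent [Fintype G] (hA : IsDecomp 𝒜) (hX : IsGradedLeft 𝒜 𝒳)
    (hZ : IsGradedLeft 𝒜 𝒵) (g : G) (φ : X →ₗ[A] Z) : X →ₗ[A] Z where
  toFun x := ∑ h, hZ.decomp.proj (h * g) (φ (hX.decomp.proj h x))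
  map_add' x y := by simp only [map_add, Finset.sum_add_distrib]
  map_smul' a x := by
    rw [RingHom.id_apply]
    -- By additivity `a` may be taken in some `A_j`. The sum is then reindexed by `h ↦ j h`, which
    -- is compatible with the shift by `g` because that shift multiplies on the other side.
    refine hA.induction (C := fun a => ∑ h, hZ.decomp.proj (h * g) (φ (hX.decomp.proj h (a • x))) =
      a • ∑ h, hZ.decomp.proj (h * g) (φ (hX.decomp.proj h x))) ?_ ?_ ?_ a
    · intro j a ha
      rw [Finset.smul_sum, ← Equiv.sum_comp (Equiv.mulLeft j)]
      refine Finset.sum_congr rfl fun h _ => ?_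
      rw [Equiv.coe_mulLeft, hX.proj_smul ha, map_smul, mul_assoc, hZ.proj_smul ha]
    · simp only [zero_smul, map_zero, Finset.sum_const_zero]
    · intro a b ha hb
      simp only [add_smul, map_add, Finset.sum_add_distrib, ha, hb]

theorem homComponent_apply_of_mem [Fintype G] (hA : IsDecomp 𝒜) (hX : IsGradedLeft 𝒜 𝒳)
    (hZ : IsGradedLeft 𝒜 𝒵) (g : G) (φ : X →ₗ[A] Z) {j : G} {x : X} (hx : x ∈ 𝒳 j) :
    homComponent hA hX hZ g φ x = hZ.decomp.proj (j * g) (φ x) := by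
  change ∑ h, hZ.decomp.proj (h * g) (φ (hX.decomp.proj h x)) = _
  rw [Finset.sum_eq_single j]
  · rw [hX.decomp.proj_self hx]
  · intro h _ hh
    rw [hX.decomp.proj_of_ne hh.symm hx, map_zero, map_zero]
  · simp

/-- `Hom_A(X, A)` is a graded right module. -/
theorem IsGradedLeft.rdual [Finite G] (hA : IsStronglyGraded 𝒜 B) (hX : IsGradedLeft 𝒜 𝒳) :
    IsGradedRight 𝒜 (rdualGrading 𝒜 𝒳) := by
  cases nonempty_fintype G
  have hA' : IsGradedLeft 𝒜 𝒜 := .of_decomp hA.decomp fun g h a b ha hb => hA.mul_mem ha hb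
  have hext : ∀ φ ψ : RDual A X, (∀ j, ∀ x ∈ 𝒳 j, φ x = ψ x) → φ = ψ := fun φ ψ H =>
    LinearMap.restrictScalars_injective k (hX.decomp.hom_ext H)
  let π : G → RDual A X →ₗ[k] RDual A X := fun g =>
    { toFun := homComponent hA.decomp hX hA' g
      map_add' := fun φ ψ => hext _ _ fun j x hx => by
        simp only [LinearMap.add_apply, homComponent_apply_of_mem _ _ _ _ _ hx, map_add]
      map_smul' := fun c φ => hext _ _ fun j x hx => by
        simp only [LinearMap.smul_apply, homComponent_apply_of_mem _ _ _ _ _ hx, map_smul,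
          RingHom.id_apply] }
  have hπ : ∀ g φ, ∀ j, ∀ x ∈ 𝒳 j, π g φ x = hA.decomp.proj (j * g) (φ x) := fun g φ j x hx =>
    homComponent_apply_of_mem hA.decomp hX hA' g φ hx
  refine .of_decomp (.of_projections ?_ π ?_ ?_) ?_
  · rw [eq_top_iff]
    rintro φ -
    -- On `X_j` the summands are the components of `φ x` in the degrees `j g`, and these run once
    -- through all of `G`.
    have : φ = ∑ g, π g φ := hext _ _ fun j x hx => by
      rw [LinearMap.sum_apply, Finset.sum_congr rfl fun g _ => hπ g φ j x hx]
      refine (hA.decomp.sum_proj (φ x)).symm.trans ?_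
      exact (Equiv.sum_comp (Equiv.mulLeft j) fun g => hA.decomp.proj g (φ x)).symm
    rw [this]
    refine Submodule.sum_mem _ fun g _ => Submodule.mem_iSup_of_mem g fun j x hx => ?_
    rw [hπ g φ j x hx]
    exact hA.decomp.proj_mem _ _
  · intro g φ hφ
    refine hext _ _ fun j x hx => ?_
    rw [hπ g φ j x hx, hA.decomp.proj_self (hφ j x hx)]
  · intro g h hh φ hφ
    refine hext _ _ fun j x hx => ?_
    rw [hπ g φ j x hx, hA.decomp.proj_of_ne (fun H => hh (mul_left_cancel H)) (hφ j x hx),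
      LinearMap.zero_apply]
  · intro g h a φ ha hφ j x hx
    rw [RDual.op_smul_apply, ← mul_assoc]
    exact hA.mul_mem (hφ j x hx) ha

end HomComponent

end Graded


/-! ### Induced modules: universal property, grading, and the degree-one part. -/

section Ind

variable {k : Type*} [Field k] {G : Type*} [Group G] {A : Type*} [Ring A] [Algebra k A]
  {𝒜 : G → Submodule k A} {B : Subalgebra k A}

section LeftInd

variable {Y : Type*} [AddCommGroup Y] [Module k Y] [Module B Y]
  {Z : Type*} [AddCommGroup Z] [Module k Z]

namespace Ind

theorem tmul_smul (a : A) (b : B) (y : Y) : Ind.tmul B a (b • y) = Ind.tmul B (a * b) y :=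
  ((Submodule.Quotient.eq _).2 (Submodule.subset_span (by exact ⟨a, b, y, rfl⟩))).symm

theorem smul_one_tmul (a : A) (y : Y) : a • Ind.tmul B 1 y = Ind.tmul B a y := by
  rw [Ind.smul_tmul, mul_one]

variable (B Y) in
/-- The bilinear map `(a, y) ↦ a ⊗ y`. -/
noncomputable def mk : A →ₗ[k] Y →ₗ[k] Ind B Y :=
  (TensorProduct.mk k A Y).compr₂ ((indRel B Y).mkQ.restrictScalars k)

theorem mk_apply (a : A) (y : Y) : mk B Y a y = Ind.tmul B a y := rfl

theorem span_tmul : Submodule.span k {t : Ind B Y | ∃ (a : A) (y : Y), t = Ind.tmul B a y} = ⊤ := by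
  rw [eq_top_iff]
  rintro t -
  obtain ⟨t, rfl⟩ := Submodule.Quotient.mk_surjective _ t
  induction t using TensorProduct.induction_on with
  | zero => exact zero_mem _
  | tmul a y => exact Submodule.subset_span ⟨a, y, rfl⟩
  | add s t hs ht => exact add_mem hs ht

theorem hom_ext {φ ψ : Ind B Y →ₗ[k] Z} (h : ∀ a y, φ (Ind.tmul B a y) = ψ (Ind.tmul B a y)) :
    φ = ψ := by
  refine LinearMap.ext_on span_tmul ?_
  rintro _ ⟨a, y, rfl⟩
  exact h a y

/-- Balanced bilinear maps factor through `A ⊗_B Y`. -/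
noncomputable def lift (L : A →ₗ[k] Y →ₗ[k] Z)
    (hL : ∀ (a : A) (b : B) (y : Y), L (a * b) y = L a (b • y)) : Ind B Y →ₗ[k] Z :=
  (((indRel B Y).restrictScalars k).liftQ (TensorProduct.lift L) (by
    intro t ht
    rw [LinearMap.mem_ker]
    -- The relations are spanned over `A` while the map is only `k`-linear, so the induction has to
    -- carry all multiples `c • t`.
    have key : ∀ c : A, TensorProduct.lift L (c • t) = 0 := by
      refine Submodule.span_induction (p := fun t _ => ∀ c : A, TensorProduct.lift L (c • t) = 0)
        ?_ ?_ ?_ ?_ ht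
      · rintro _ ⟨a, b, y, rfl⟩ c
        rw [smul_sub, TensorProduct.smul_tmul', TensorProduct.smul_tmul', map_sub,
          TensorProduct.lift.tmul, TensorProduct.lift.tmul, smul_eq_mul, smul_eq_mul, ← mul_assoc,
          hL, sub_self]
      · intro c
        rw [smul_zero, map_zero]
      · intro s t _ _ hs ht c
        rw [smul_add, map_add, hs, ht, add_zero]
      · intro d t _ ht c
        rw [smul_smul, ht]
    rw [← one_smul A t, key])) ∘ₗ
    (Submodule.Quotient.restrictScalarsEquiv k (indRel B Y)).symm.toLinearMap

section liftHom

variable [Module A Z] [IsScalarTower k A Z]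

/-- A `B`-linear map `L : Y → Z` to an `A`-module extends to `A ⊗_B Y`, by `a ⊗ y ↦ a L(y)`. -/
noncomputable def liftHom (L : Y →ₗ[k] Z) (hL : ∀ (b : B) (y : Y), L (b • y) = (b : A) • L y) :
    Ind B Y →ₗ[A] Z :=
  let φ : Ind B Y →ₗ[k] Z :=
    lift (LinearMap.lcomp k Z L ∘ₗ (Algebra.lsmul k k Z).toLinearMap) (fun a b y => by
      change (a * (b : A)) • L y = a • L (b • y)
      rw [hL, mul_smul])
  { φ with
    map_smul' := fun c t => by
      refine LinearMap.congr_fun (f := φ ∘ₗ Algebra.lsmul k k (Ind B Y) c)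
        (g := Algebra.lsmul k k Z c ∘ₗ φ) (hom_ext fun a y => ?_) t
      exact mul_smul c a (L y) }

theorem liftHom_tmul (L : Y →ₗ[k] Z) (hL : ∀ (b : B) (y : Y), L (b • y) = (b : A) • L y) (a : A)
    (y : Y) : liftHom L hL (Ind.tmul B a y) = a • L y := rfl

end liftHom

/-- The projection `A ⊗_B Y → A_g ⊗_B Y`. -/
noncomputable def proj (hA : IsStronglyGraded 𝒜 B) (Y : Type*) [AddCommGroup Y] [Module k Y]
    [Module B Y] (g : G) : Ind B Y →ₗ[k] Ind B Y :=
  lift (mk B Y ∘ₗ hA.decomp.proj g) fun a b y => by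
    simp only [LinearMap.comp_apply, hA.proj_mul_coe, mk_apply, tmul_smul]

theorem proj_tmul (hA : IsStronglyGraded 𝒜 B) (g : G) (a : A) (y : Y) :
    proj hA Y g (Ind.tmul B a y) = Ind.tmul B (hA.decomp.proj g a) y := rfl

omit [Group G] in
theorem tmul_mem {g : G} {a : A} (ha : a ∈ 𝒜 g) (y : Y) : Ind.tmul B a y ∈ indGrading B 𝒜 Y g :=
  Submodule.subset_span ⟨a, ha, y, rfl⟩

theorem tmul_zero (a : A) : Ind.tmul B a (0 : Y) = 0 := map_zero (mk B Y a)

theorem zero_tmul (y : Y) : Ind.tmul B 0 y = 0 := LinearMap.map_zero₂ (mk B Y) y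

theorem tmul_add (a : A) (y z : Y) : Ind.tmul B a (y + z) = Ind.tmul B a y + Ind.tmul B a z :=
  map_add (mk B Y a) y z

omit [Group G] in
/-- A linear map out of `A ⊗_B Y` preserves degrees if it does so on generators. -/
theorem map_mem_of_tmul {φ : Ind B Y →ₗ[k] Z} {g : G} {S : Submodule k Z}
    (h : ∀ a ∈ 𝒜 g, ∀ y, φ (Ind.tmul B a y) ∈ S) {x : Ind B Y} (hx : x ∈ indGrading B 𝒜 Y g) :
    φ x ∈ S := by
  refine (Submodule.span_le (p := S.comap φ)).2 ?_ hx
  rintro _ ⟨a, ha, y, rfl⟩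
  exact h a ha y

omit [Group G] in
theorem eq_of_tmul {φ ψ : Ind B Y →ₗ[k] Z} {g : G}
    (h : ∀ a ∈ 𝒜 g, ∀ y, φ (Ind.tmul B a y) = ψ (Ind.tmul B a y)) {x : Ind B Y}
    (hx : x ∈ indGrading B 𝒜 Y g) : φ x = ψ x := by
  refine LinearMap.eqOn_span (f := φ) (g := ψ) ?_ hx
  rintro _ ⟨a, ha, y, rfl⟩
  exact h a ha y

end Ind

theorem IsStronglyGraded.ind (hA : IsStronglyGraded 𝒜 B) (Y : Type*) [AddCommGroup Y] [Module k Y]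
    [Module B Y] : IsGradedLeft 𝒜 (indGrading B 𝒜 Y) := by
  refine .of_decomp (.of_projections ?_ (Ind.proj hA Y) ?_ ?_) ?_
  · rw [eq_top_iff, ← Ind.span_tmul, Submodule.span_le]
    rintro _ ⟨a, y, rfl⟩
    have : LinearMap.range ((Ind.mk B Y).flip y) ≤ ⨆ g, indGrading B 𝒜 Y g := by
      rw [← Submodule.map_top, ← hA.iSup_eq_top, Submodule.map_iSup]
      refine iSup_mono fun g => ?_
      rintro _ ⟨a, ha, rfl⟩
      exact Ind.tmul_mem ha y
    exact this ⟨a, rfl⟩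
  · intro g x hx
    refine Ind.eq_of_tmul (ψ := LinearMap.id) (fun a ha y => ?_) hx
    rw [Ind.proj_tmul, hA.decomp.proj_self ha, LinearMap.id_apply]
  · intro g h hh x hx
    refine Ind.eq_of_tmul (ψ := 0) (fun a ha y => ?_) hx
    rw [Ind.proj_tmul, hA.decomp.proj_of_ne hh ha, Ind.zero_tmul, LinearMap.zero_apply]
  · intro g h a x ha hx
    refine Ind.map_mem_of_tmul (φ := Algebra.lsmul k k (Ind B Y) a) (fun c hc y => ?_) hx
    exact Ind.tmul_mem (hA.mul_mem ha hc) y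

/-- Since `A_1 = B`, the first factor moves across the tensor sign. Together with
`Ind.one_tmul_injective` this identifies the degree-`1` part with `Y`. -/
theorem Ind.eq_one_tmul (hA : IsStronglyGraded 𝒜 B) {x : Ind B Y} (hx : x ∈ indGrading B 𝒜 Y 1) :
    ∃ y, x = Ind.tmul B 1 y := by
  have : indGrading B 𝒜 Y 1 ≤ LinearMap.range (Ind.mk B Y 1) := by
    rw [indGrading, Submodule.span_le]
    rintro _ ⟨a, ha, y, rfl⟩
    refine ⟨(⟨a, hA.mem_one_iff.1 ha⟩ : B) • y, ?_⟩
    rw [Ind.mk_apply, Ind.tmul_smul, one_mul]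
  obtain ⟨y, hy⟩ := this hx
  exact ⟨y, hy.symm⟩

section toBase

variable [IsScalarTower k B Y]

/-- The projection `A ⊗_B Y → B ⊗_B Y = Y`. -/
noncomputable def Ind.toBase (hA : IsStronglyGraded 𝒜 B) (Y : Type*) [AddCommGroup Y] [Module k Y]
    [Module B Y] [IsScalarTower k B Y] : Ind B Y →ₗ[k] Y :=
  Ind.lift ((Algebra.lsmul k k Y).toLinearMap ∘ₗ hA.toBase) fun a b y => by
    change hA.toBase (a * b) • y = hA.toBase a • b • y
    rw [hA.toBase_mul_coe, mul_smul]

theorem Ind.toBase_tmul (hA : IsStronglyGraded 𝒜 B) (a : A) (y : Y) :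
    Ind.toBase hA Y (Ind.tmul B a y) = hA.toBase a • y := rfl

theorem Ind.toBase_one_tmul (hA : IsStronglyGraded 𝒜 B) (y : Y) :
    Ind.toBase hA Y (Ind.tmul B 1 y) = y := by
  rw [Ind.toBase_tmul, hA.toBase_one, one_smul]

theorem Ind.one_tmul_injective (hA : IsStronglyGraded 𝒜 B) :
    Function.Injective (Ind.tmul B (1 : A) (Y := Y)) :=
  Function.LeftInverse.injective (Ind.toBase_one_tmul hA)

theorem Ind.toBase_smul (hA : IsStronglyGraded 𝒜 B) (b : B) (x : Ind B Y) :
    Ind.toBase hA Y ((b : A) • x) = b • Ind.toBase hA Y x := by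
  refine LinearMap.congr_fun (f := Ind.toBase hA Y ∘ₗ Algebra.lsmul k k (Ind B Y) (b : A))
    (g := Algebra.lsmul k k Y b ∘ₗ Ind.toBase hA Y) (Ind.hom_ext fun a y => ?_) x
  change hA.toBase (b * a) • y = b • hA.toBase a • y
  rw [hA.toBase_coe_mul, mul_smul]

theorem Ind.toBase_of_ne (hA : IsStronglyGraded 𝒜 B) {g : G} (hg : g ≠ 1) {x : Ind B Y}
    (hx : x ∈ indGrading B 𝒜 Y g) : Ind.toBase hA Y x = 0 := by
  refine Ind.eq_of_tmul (ψ := 0) (fun a ha y => ?_) hx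
  rw [Ind.toBase_tmul, hA.toBase_of_ne hg ha, zero_smul, LinearMap.zero_apply]

end toBase

end LeftInd

section RightInd

open MulOpposite

variable {N : Type*} [AddCommGroup N] [Module k N] [Module Bᵐᵒᵖ N]
  {Z : Type*} [AddCommGroup Z] [Module k Z]

namespace RInd

theorem smul_tmul (a : A) (b : B) (n : N) :
    RInd.tmul B (op b • n) a = RInd.tmul B n ((b : A) * a) :=
  ((Submodule.Quotient.eq _).2 (Submodule.subset_span (by exact ⟨a, b, n, rfl⟩))).symm

variable (B N) in
/-- The bilinear map `(a, n) ↦ n ⊗ a`. -/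
noncomputable def mk : A →ₗ[k] N →ₗ[k] RInd B N :=
  (TensorProduct.mk k A N).compr₂ ((rindRel B N).mkQ.restrictScalars k)

theorem mk_apply (a : A) (n : N) : mk B N a n = RInd.tmul B n a := rfl

theorem span_tmul :
    Submodule.span k {t : RInd B N | ∃ (a : A) (n : N), t = RInd.tmul B n a} = ⊤ := by
  rw [eq_top_iff]
  rintro t -
  obtain ⟨t, rfl⟩ := Submodule.Quotient.mk_surjective _ t
  induction t using TensorProduct.induction_on with
  | zero => exact zero_mem _
  | tmul a n => exact Submodule.subset_span ⟨a, n, rfl⟩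
  | add s t hs ht => exact add_mem hs ht

theorem hom_ext {φ ψ : RInd B N →ₗ[k] Z} (h : ∀ a n, φ (RInd.tmul B n a) = ψ (RInd.tmul B n a)) :
    φ = ψ := by
  refine LinearMap.ext_on span_tmul ?_
  rintro _ ⟨a, n, rfl⟩
  exact h a n

/-- Balanced bilinear maps factor through `N ⊗_B A`. -/
noncomputable def lift (L : A →ₗ[k] N →ₗ[k] Z)
    (hL : ∀ (a : A) (b : B) (n : N), L ((b : A) * a) n = L a (op b • n)) : RInd B N →ₗ[k] Z :=
  (((rindRel B N).restrictScalars k).liftQ (TensorProduct.lift L) (by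
    intro t ht
    rw [LinearMap.mem_ker]
    have key : ∀ c : Aᵐᵒᵖ, TensorProduct.lift L (c • t) = 0 := by
      refine Submodule.span_induction (p := fun t _ => ∀ c : Aᵐᵒᵖ, TensorProduct.lift L (c • t) = 0)
        ?_ ?_ ?_ ?_ ht
      · rintro _ ⟨a, b, n, rfl⟩ c
        rw [smul_sub, TensorProduct.smul_tmul', TensorProduct.smul_tmul', map_sub,
          TensorProduct.lift.tmul, TensorProduct.lift.tmul, smul_eq_mul_unop, smul_eq_mul_unop,
          mul_assoc, hL, sub_self]
      · intro c
        rw [smul_zero, map_zero]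
      · intro s t _ _ hs ht c
        rw [smul_add, map_add, hs, ht, add_zero]
      · intro d t _ ht c
        rw [smul_smul, ht]
    rw [← one_smul Aᵐᵒᵖ t, key])) ∘ₗ
    (Submodule.Quotient.restrictScalarsEquiv k (rindRel B N)).symm.toLinearMap

section liftHom

variable [Module Aᵐᵒᵖ Z] [IsScalarTower k Aᵐᵒᵖ Z]

/-- A `B`-linear map `L : N → Z` to a right `A`-module extends to `N ⊗_B A`, by
`n ⊗ a ↦ L(n) a`. -/
noncomputable def liftHom (L : N →ₗ[k] Z) (hL : ∀ (b : B) (n : N), L (op b • n) = op (b : A) • L n) :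
    RInd B N →ₗ[Aᵐᵒᵖ] Z :=
  let φ : RInd B N →ₗ[k] Z :=
    lift (LinearMap.lcomp k Z L ∘ₗ (Algebra.lsmul k k Z).toLinearMap ∘ₗ
        (opLinearEquiv k).toLinearMap) (fun a b n => by
      change op ((b : A) * a) • L n = op a • L (op b • n)
      rw [hL, op_mul, mul_smul])
  { φ with
    map_smul' := fun c t => by
      refine LinearMap.congr_fun (f := φ ∘ₗ Algebra.lsmul k k (RInd B N) c)
        (g := Algebra.lsmul k k Z c ∘ₗ φ) (hom_ext fun a n => ?_) t
      exact mul_smul c (op a) (L n) }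

theorem liftHom_tmul (L : N →ₗ[k] Z) (hL : ∀ (b : B) (n : N), L (op b • n) = op (b : A) • L n)
    (a : A) (n : N) : liftHom L hL (RInd.tmul B n a) = op a • L n := rfl

end liftHom

/-- The projection `N ⊗_B A → N ⊗_B A_g`. -/
noncomputable def proj (hA : IsStronglyGraded 𝒜 B) (N : Type*) [AddCommGroup N] [Module k N]
    [Module Bᵐᵒᵖ N] (g : G) : RInd B N →ₗ[k] RInd B N :=
  lift (mk B N ∘ₗ hA.decomp.proj g) fun a b n => by
    simp only [LinearMap.comp_apply, hA.proj_coe_mul, mk_apply, smul_tmul]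

theorem proj_tmul (hA : IsStronglyGraded 𝒜 B) (g : G) (a : A) (n : N) :
    proj hA N g (RInd.tmul B n a) = RInd.tmul B n (hA.decomp.proj g a) := rfl

omit [Group G] in
theorem tmul_mem {g : G} {a : A} (ha : a ∈ 𝒜 g) (n : N) :
    RInd.tmul B n a ∈ rindGrading B 𝒜 N g :=
  Submodule.subset_span ⟨a, ha, n, rfl⟩

theorem zero_tmul (a : A) : RInd.tmul B (0 : N) a = 0 := map_zero (mk B N a)

theorem tmul_zero (n : N) : RInd.tmul B n (0 : A) = 0 := LinearMap.map_zero₂ (mk B N) n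

omit [Group G] in
/-- A linear map out of `N ⊗_B A` preserves degrees if it does so on generators. -/
theorem map_mem_of_tmul {φ : RInd B N →ₗ[k] Z} {g : G} {S : Submodule k Z}
    (h : ∀ a ∈ 𝒜 g, ∀ n, φ (RInd.tmul B n a) ∈ S) {x : RInd B N} (hx : x ∈ rindGrading B 𝒜 N g) :
    φ x ∈ S := by
  refine (Submodule.span_le (p := S.comap φ)).2 ?_ hx
  rintro _ ⟨a, ha, n, rfl⟩
  exact h a ha n

omit [Group G] in
theorem eq_of_tmul {φ ψ : RInd B N →ₗ[k] Z} {g : G}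
    (h : ∀ a ∈ 𝒜 g, ∀ n, φ (RInd.tmul B n a) = ψ (RInd.tmul B n a)) {x : RInd B N}
    (hx : x ∈ rindGrading B 𝒜 N g) : φ x = ψ x := by
  refine LinearMap.eqOn_span (f := φ) (g := ψ) ?_ hx
  rintro _ ⟨a, ha, n, rfl⟩
  exact h a ha n

end RInd

theorem IsStronglyGraded.rind (hA : IsStronglyGraded 𝒜 B) (N : Type*) [AddCommGroup N] [Module k N]
    [Module Bᵐᵒᵖ N] : IsGradedRight 𝒜 (rindGrading B 𝒜 N) := by
  refine .of_decomp (.of_projections ?_ (RInd.proj hA N) ?_ ?_) ?_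
  · rw [eq_top_iff, ← RInd.span_tmul, Submodule.span_le]
    rintro _ ⟨a, n, rfl⟩
    have : LinearMap.range ((RInd.mk B N).flip n) ≤ ⨆ g, rindGrading B 𝒜 N g := by
      rw [← Submodule.map_top, ← hA.iSup_eq_top, Submodule.map_iSup]
      refine iSup_mono fun g => ?_
      rintro _ ⟨a, ha, rfl⟩
      exact RInd.tmul_mem ha n
    exact this ⟨a, rfl⟩
  · intro g x hx
    refine RInd.eq_of_tmul (ψ := LinearMap.id) (fun a ha n => ?_) hx
    rw [RInd.proj_tmul, hA.decomp.proj_self ha, LinearMap.id_apply]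
  · intro g h hh x hx
    refine RInd.eq_of_tmul (ψ := 0) (fun a ha n => ?_) hx
    rw [RInd.proj_tmul, hA.decomp.proj_of_ne hh ha, RInd.tmul_zero, LinearMap.zero_apply]
  · intro g h a x ha hx
    refine RInd.map_mem_of_tmul (φ := Algebra.lsmul k k (RInd B N) (op a)) (fun c hc n => ?_) hx
    exact RInd.tmul_mem (hA.mul_mem hc ha) n

theorem RInd.eq_tmul_one (hA : IsStronglyGraded 𝒜 B) {x : RInd B N}
    (hx : x ∈ rindGrading B 𝒜 N 1) : ∃ n, x = RInd.tmul B n 1 := by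
  have : rindGrading B 𝒜 N 1 ≤ LinearMap.range (RInd.mk B N 1) := by
    rw [rindGrading, Submodule.span_le]
    rintro _ ⟨a, ha, n, rfl⟩
    refine ⟨op (⟨a, hA.mem_one_iff.1 ha⟩ : B) • n, ?_⟩
    rw [RInd.mk_apply, RInd.smul_tmul, mul_one]
  obtain ⟨n, hn⟩ := this hx
  exact ⟨n, hn.symm⟩

section toBase

variable [IsScalarTower k Bᵐᵒᵖ N]

/-- The projection `N ⊗_B A → N ⊗_B B = N`. -/
noncomputable def RInd.toBase (hA : IsStronglyGraded 𝒜 B) (N : Type*) [AddCommGroup N] [Module k N]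
    [Module Bᵐᵒᵖ N] [IsScalarTower k Bᵐᵒᵖ N] : RInd B N →ₗ[k] N :=
  RInd.lift ((Algebra.lsmul k k N).toLinearMap ∘ₗ (opLinearEquiv k).toLinearMap ∘ₗ hA.toBase)
    fun a b n => by
      change op (hA.toBase (b * a)) • n = op (hA.toBase a) • op b • n
      rw [hA.toBase_coe_mul, op_mul, mul_smul]

theorem RInd.toBase_tmul (hA : IsStronglyGraded 𝒜 B) (a : A) (n : N) :
    RInd.toBase hA N (RInd.tmul B n a) = op (hA.toBase a) • n := rfl

theorem RInd.toBase_tmul_one (hA : IsStronglyGraded 𝒜 B) (n : N) :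
    RInd.toBase hA N (RInd.tmul B n 1) = n := by
  rw [RInd.toBase_tmul, hA.toBase_one, op_one, one_smul]

theorem RInd.toBase_smul (hA : IsStronglyGraded 𝒜 B) (b : B) (x : RInd B N) :
    RInd.toBase hA N (op (b : A) • x) = op b • RInd.toBase hA N x := by
  refine LinearMap.congr_fun (f := RInd.toBase hA N ∘ₗ Algebra.lsmul k k (RInd B N) (op (b : A)))
    (g := Algebra.lsmul k k N (op b) ∘ₗ RInd.toBase hA N) (RInd.hom_ext fun a n => ?_) x
  change op (hA.toBase (a * b)) • n = op b • op (hA.toBase a) • n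
  rw [hA.toBase_mul_coe, op_mul, mul_smul]

theorem RInd.toBase_of_ne (hA : IsStronglyGraded 𝒜 B) {g : G} (hg : g ≠ 1) {x : RInd B N}
    (hx : x ∈ rindGrading B 𝒜 N g) : RInd.toBase hA N x = 0 := by
  refine RInd.eq_of_tmul (ψ := 0) (fun a ha n => ?_) hx
  rw [RInd.toBase_tmul, hA.toBase_of_ne hg ha, op_zero, zero_smul, LinearMap.zero_apply]

end toBase

end RightInd

/-! ### The `k`-dual of an induced module. -/

section Duality

open MulOpposite

variable [Finite G]

/-- `DY ⊗_B A ≅ D(A ⊗_B Y)`. -/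
theorem rind_kdual_iso (hA : IsStronglyGraded 𝒜 B) (Y : Type*) [AddCommGroup Y] [Module k Y]
    [Module B Y] [IsScalarTower k B Y] :
    GradedIsoRight 𝒜 (rindGrading B 𝒜 (KDual k Y)) (dualGrading (indGrading B 𝒜 Y)) := by
  -- A functional on `Y`, the degree-`1` part, is extended by zero to the other degrees.
  let L : KDual k Y →ₗ[k] KDual k (Ind B Y) :=
    { toFun := fun φ => LinearMap.comp (M₂ := Y) φ (Ind.toBase hA Y)
      map_add' := fun _ _ => rfl
      map_smul' := fun _ _ => rfl }
  have hL : ∀ φ x, L φ x = φ (Ind.toBase hA Y x) := fun _ _ => rfl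
  have hLB : ∀ (b : B) φ, L (op b • φ) = op (b : A) • L φ := fun b φ =>
    LinearMap.ext fun x => congrArg φ (Ind.toBase_smul hA b x).symm
  have hLmem : ∀ φ, L φ ∈ dualGrading (indGrading B 𝒜 Y) 1 := by
    intro φ j hj x hx
    rw [hL, Ind.toBase_of_ne hA (by simpa using hj) hx]
    exact LinearMap.map_zero φ
  have hgr := (hA.ind Y).dual
  refine .of_degree_one hA (hA.rind _) hgr (RInd.liftHom L hLB) ?_ ?_ ?_
  · intro g x hx
    refine RInd.map_mem_of_tmul (φ := (RInd.liftHom L hLB).restrictScalars k) (fun a ha φ => ?_) hx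
    have := hgr.smul_mem g 1 a _ ha (hLmem φ)
    rwa [one_mul] at this
  · intro x hx h0
    obtain ⟨φ, rfl⟩ := RInd.eq_tmul_one hA hx
    rw [RInd.liftHom_tmul, op_one, one_smul] at h0
    have : φ = 0 := LinearMap.ext fun y => by
      have h1 := hL φ (Ind.tmul B 1 y)
      rw [h0, Ind.toBase_one_tmul] at h1
      exact h1.symm
    rw [this, RInd.zero_tmul]
  · intro f hf
    let φ : KDual k Y := LinearMap.comp (M₂ := Ind B Y) f (Ind.mk B Y 1)
    refine ⟨RInd.tmul B φ 1, ?_⟩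
    rw [RInd.liftHom_tmul, op_one, one_smul]
    -- In degree `1` the two functionals agree because `Ind.toBase` undoes `1 ⊗ -`; in the other
    -- degrees both vanish, `f` being of degree `1`.
    refine (hA.ind Y).decomp.hom_ext (φ := L φ) (ψ := f) fun j x hx => ?_
    change f (Ind.tmul B 1 (Ind.toBase hA Y x)) = f x
    by_cases hj : j = 1
    · subst hj
      obtain ⟨y, rfl⟩ := Ind.eq_one_tmul hA hx
      rw [Ind.toBase_one_tmul]
    · rw [Ind.toBase_of_ne hA hj hx, Ind.tmul_zero, hf j (by simpa using hj) x hx]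
      exact LinearMap.map_zero f

/-- `A ⊗_B DN ≅ D(N ⊗_B A)`. -/
theorem ind_kdual_iso (hA : IsStronglyGraded 𝒜 B) (N : Type*) [AddCommGroup N] [Module k N]
    [Module Bᵐᵒᵖ N] [IsScalarTower k Bᵐᵒᵖ N] :
    GradedIsoLeft 𝒜 (indGrading B 𝒜 (KDual k N)) (dualGrading (rindGrading B 𝒜 N)) := by
  let L : KDual k N →ₗ[k] KDual k (RInd B N) :=
    { toFun := fun φ => LinearMap.comp (M₂ := N) φ (RInd.toBase hA N)
      map_add' := fun _ _ => rfl
      map_smul' := fun _ _ => rfl }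
  have hL : ∀ φ x, L φ x = φ (RInd.toBase hA N x) := fun _ _ => rfl
  have hLB : ∀ (b : B) φ, L (b • φ) = (b : A) • L φ := fun b φ =>
    LinearMap.ext fun x => congrArg φ (RInd.toBase_smul hA b x).symm
  have hLmem : ∀ φ, L φ ∈ dualGrading (rindGrading B 𝒜 N) 1 := by
    intro φ j hj x hx
    rw [hL, RInd.toBase_of_ne hA (by simpa using hj) hx]
    exact LinearMap.map_zero φ
  have hgr := (hA.rind N).dual
  refine .of_degree_one hA (hA.ind _) hgr (Ind.liftHom L hLB) ?_ ?_ ?_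
  · intro g x hx
    refine Ind.map_mem_of_tmul (φ := (Ind.liftHom L hLB).restrictScalars k) (fun a ha φ => ?_) hx
    have := hgr.smul_mem g 1 a _ ha (hLmem φ)
    rwa [mul_one] at this
  · intro x hx h0
    obtain ⟨φ, rfl⟩ := Ind.eq_one_tmul hA hx
    rw [Ind.liftHom_tmul, one_smul] at h0
    have : φ = 0 := LinearMap.ext fun n => by
      have h1 := hL φ (RInd.tmul B n 1)
      rw [h0, RInd.toBase_tmul_one] at h1
      exact h1.symm
    rw [this, Ind.tmul_zero]
  · intro f hf
    let φ : KDual k N := LinearMap.comp (M₂ := RInd B N) f (RInd.mk B N 1)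
    refine ⟨Ind.tmul B 1 φ, ?_⟩
    rw [Ind.liftHom_tmul, one_smul]
    refine (hA.rind N).decomp.hom_ext (φ := L φ) (ψ := f) fun j x hx => ?_
    change f (RInd.tmul B (RInd.toBase hA N x) 1) = f x
    by_cases hj : j = 1
    · subst hj
      obtain ⟨n, rfl⟩ := RInd.eq_tmul_one hA hx
      rw [RInd.toBase_tmul_one]
    · rw [RInd.toBase_of_ne hA hj hx, RInd.zero_tmul, hf j (by simpa using hj) x hx]
      exact LinearMap.map_zero f

end Duality

end Ind


/-! ### The ring dual of an induced module, and cokernels of dual maps. -/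

section RDualInd

open MulOpposite

variable {k : Type*} [Field k] {G : Type*} [Group G] {A : Type*} [Ring A] [Algebra k A]
  {𝒜 : G → Submodule k A} {B : Subalgebra k A}
  {Y : Type*} [AddCommGroup Y] [Module k Y] [Module B Y] [IsScalarTower k B Y]
  {M : Type*} [AddCommGroup M] [Module k M] [Module B M] [IsScalarTower k B M]

omit [IsScalarTower k B Y] in
theorem Ind.hom_ext_left {Z : Type*} [AddCommGroup Z] [Module k Z] [Module A Z]
    [IsScalarTower k A Z] {φ ψ : Ind B Y →ₗ[A] Z}
    (h : ∀ y, φ (Ind.tmul B 1 y) = ψ (Ind.tmul B 1 y)) : φ = ψ := by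
  refine LinearMap.restrictScalars_injective k (Ind.hom_ext fun a y => ?_)
  rw [← Ind.smul_one_tmul]
  simp only [LinearMap.coe_restrictScalars, map_smul, h]

/-- The functor `A ⊗_B -` on maps. -/
noncomputable def Ind.map (q : Y →ₗ[B] M) : Ind B Y →ₗ[A] Ind B M :=
  Ind.liftHom (Ind.mk B M 1 ∘ₗ q.restrictScalars k) fun b y => by
    change Ind.tmul B 1 (q (b • y)) = (b : A) • Ind.tmul B 1 (q y)
    rw [map_smul, Ind.tmul_smul, one_mul, Ind.smul_one_tmul]

theorem Ind.map_tmul (q : Y →ₗ[B] M) (a : A) (y : Y) :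
    Ind.map q (Ind.tmul B a y) = Ind.tmul B a (q y) := Ind.smul_one_tmul a (q y)

omit [Group G] in
theorem Ind.map_mem (q : Y →ₗ[B] M) (g : G) {x : Ind B Y} (hx : x ∈ indGrading B 𝒜 Y g) :
    Ind.map q x ∈ indGrading B 𝒜 M g := by
  refine Ind.map_mem_of_tmul (φ := (Ind.map q).restrictScalars k) (fun a ha y => ?_) hx
  rw [LinearMap.restrictScalars_apply, Ind.map_tmul]
  exact Ind.tmul_mem ha _

theorem RDual.coe_map_smul (φ : RDual B Y) (b : B) (y : Y) :
    (B.val.toLinearMap ∘ₗ φ.restrictScalars k) (b • y) =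
      (b : A) • (B.val.toLinearMap ∘ₗ φ.restrictScalars k) y :=
  congrArg Subtype.val (map_smul φ b y)

/-- The map `Hom_B(Y, B) → Hom_A(A ⊗_B Y, A)`, `φ ↦ (a ⊗ y ↦ a φ(y))`. -/
noncomputable def RDual.ind (B : Subalgebra k A) (Y : Type*) [AddCommGroup Y] [Module k Y]
    [Module B Y] [IsScalarTower k B Y] : RDual B Y →ₗ[k] RDual A (Ind B Y) where
  toFun φ := Ind.liftHom (B.val.toLinearMap ∘ₗ φ.restrictScalars k) (RDual.coe_map_smul φ)
  map_add' φ ψ := Ind.hom_ext_left fun y => by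
    rw [LinearMap.add_apply, Ind.liftHom_tmul, Ind.liftHom_tmul, Ind.liftHom_tmul, ← smul_add]
    rfl
  map_smul' c φ := Ind.hom_ext_left fun y => by
    rw [RingHom.id_apply, LinearMap.smul_apply, Ind.liftHom_tmul, Ind.liftHom_tmul, one_smul,
      one_smul]
    rfl

theorem RDual.ind_tmul (φ : RDual B Y) (a : A) (y : Y) :
    RDual.ind B Y φ (Ind.tmul B a y) = a * φ y := rfl

theorem RDual.ind_op_smul (b : B) (φ : RDual B Y) :
    RDual.ind B Y (op b • φ) = op (b : A) • RDual.ind B Y φ :=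
  Ind.hom_ext_left fun y => by
    rw [RDual.op_smul_apply, RDual.ind_tmul, RDual.ind_tmul, RDual.op_smul_apply, one_mul, one_mul]
    rfl

theorem RDual.ind_mem (hA : IsStronglyGraded 𝒜 B) (φ : RDual B Y) :
    RDual.ind B Y φ ∈ rdualGrading 𝒜 (indGrading B 𝒜 Y) 1 := by
  intro j x hx
  refine Ind.map_mem_of_tmul (φ := (RDual.ind B Y φ).restrictScalars k) (fun a ha y => ?_) hx
  exact hA.mul_mem ha (hA.mem_one (φ y))

/-- The restriction of `f : A ⊗_B Y → A` to `Y`, followed by the projection `A → B`. -/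
noncomputable def RDual.res (hA : IsStronglyGraded 𝒜 B) (f : RDual A (Ind B Y)) : RDual B Y where
  toFun y := hA.toBase (f (Ind.tmul B 1 y))
  map_add' y z := by rw [Ind.tmul_add, map_add, map_add]
  map_smul' b y := by
    rw [Ind.tmul_smul, one_mul, ← Ind.smul_one_tmul, map_smul, smul_eq_mul, hA.toBase_coe_mul,
      RingHom.id_apply, smul_eq_mul]

/-- For `f` of degree `1` the values `f (1 ⊗ y)` already lie in `A_1 = B`, so the projection inside
`RDual.res` loses nothing. -/
theorem RDual.ind_res (hA : IsStronglyGraded 𝒜 B) {f : RDual A (Ind B Y)}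
    (hf : f ∈ rdualGrading 𝒜 (indGrading B 𝒜 Y) 1) : RDual.ind B Y (RDual.res hA f) = f :=
  Ind.hom_ext_left fun y => by
    rw [RDual.ind_tmul, one_mul]
    refine hA.decomp.proj_self ?_
    simpa using hf 1 _ (Ind.tmul_mem hA.one_mem y)

theorem RDual.res_ind (hA : IsStronglyGraded 𝒜 B) (φ : RDual B Y) :
    RDual.res hA (RDual.ind B Y φ) = φ :=
  LinearMap.ext fun y => by
    change hA.toBase ((1 : A) * φ y) = φ y
    rw [one_mul, hA.toBase_coe]

/-- `Hom_B(Y, B) ⊗_B A ≅ Hom_A(A ⊗_B Y, A)`. -/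
theorem rind_rdual_iso [Finite G] (hA : IsStronglyGraded 𝒜 B) (Y : Type*) [AddCommGroup Y]
    [Module k Y] [Module B Y] [IsScalarTower k B Y] :
    GradedIsoRight 𝒜 (rindGrading B 𝒜 (RDual B Y)) (rdualGrading 𝒜 (indGrading B 𝒜 Y)) := by
  have hgr := (hA.ind Y).rdual hA
  refine .of_degree_one hA (hA.rind _) hgr (RInd.liftHom (RDual.ind B Y) RDual.ind_op_smul) ?_ ?_ ?_
  · intro g x hx
    refine RInd.map_mem_of_tmul
      (φ := (RInd.liftHom (RDual.ind B Y) RDual.ind_op_smul).restrictScalars k) (fun a ha φ => ?_) hx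
    have := hgr.smul_mem g 1 a _ ha (RDual.ind_mem hA φ)
    rwa [one_mul] at this
  · intro x hx h0
    obtain ⟨φ, rfl⟩ := RInd.eq_tmul_one hA hx
    rw [RInd.liftHom_tmul, op_one, one_smul] at h0
    have : φ = 0 := LinearMap.ext fun y => by
      rw [← RDual.res_ind hA φ, h0]
      exact map_zero hA.toBase
    rw [this, RInd.zero_tmul]
  · intro f hf
    refine ⟨RInd.tmul B (RDual.res hA f) 1, ?_⟩
    rw [RInd.liftHom_tmul, op_one, one_smul, RDual.ind_res hA hf]

/-- The cokernel of a homomorphism of graded right modules is graded. -/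
theorem IsGradedRight.coker {X Z : Type*} [AddCommGroup X] [Module k X] [Module Aᵐᵒᵖ X]
    [IsScalarTower k Aᵐᵒᵖ X] [AddCommGroup Z] [Module k Z] [Module Aᵐᵒᵖ Z]
    [IsScalarTower k Aᵐᵒᵖ Z] {𝒳 : G → Submodule k X} {𝒵 : G → Submodule k Z}
    (hX : IsGradedRight 𝒜 𝒳) (hZ : IsGradedRight 𝒜 𝒵) (f : X →ₗ[Aᵐᵒᵖ] Z)
    (hf : ∀ g, ∀ x ∈ 𝒳 g, f x ∈ 𝒵 g) :
    IsGradedRight 𝒜 fun g => (𝒵 g).map ((LinearMap.range f).mkQ.restrictScalars k) := by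
  refine .of_decomp (hZ.decomp.map_of_surjective ((LinearMap.range f).mkQ.restrictScalars k)
    (fun z => Submodule.Quotient.mk_surjective _ z) fun g z hz => ?_) ?_
  -- The range of `f` is stable under the projections because `f` commutes with them.
  · obtain ⟨x, rfl⟩ := (Submodule.Quotient.mk_eq_zero _).1 hz
    refine (Submodule.Quotient.mk_eq_zero _).2 ⟨hX.decomp.proj g x, ?_⟩
    exact hX.decomp.map_proj hZ.decomp (φ := f.restrictScalars k) hf g x
  · rintro g h a _ ha ⟨z, hz, rfl⟩
    exact ⟨op a • z, hZ.smul_mem _ _ _ _ ha hz, rfl⟩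

omit [IsScalarTower k B Y] [IsScalarTower k B M] [Module B Y] [Module B M] in
theorem rdualMap_mem [Module A Y] [Module A M] {𝒴 : G → Submodule k Y} {ℳ : G → Submodule k M}
    {f : Y →ₗ[A] M} (hf : ∀ g, ∀ y ∈ 𝒴 g, f y ∈ ℳ g) (g : G) {φ : RDual A M}
    (hφ : φ ∈ rdualGrading 𝒜 ℳ g) : rdualMap f φ ∈ rdualGrading 𝒜 𝒴 g :=
  fun j y hy => hφ j _ (hf j y hy)

/-- The map `Coker(f^*) → Coker((A ⊗_B f)^*)` induced by `φ ↦ (a ⊗ y ↦ a φ(y))`. -/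
noncomputable def RDual.cokerInd (f : Y →ₗ[B] M) :
    (RDual B Y ⧸ LinearMap.range (rdualMap f)) →ₗ[k]
      (RDual A (Ind B Y) ⧸ LinearMap.range (rdualMap (Ind.map f))) :=
  (((LinearMap.range (rdualMap f)).restrictScalars k).liftQ
    ((LinearMap.range (rdualMap (Ind.map f))).mkQ.restrictScalars k ∘ₗ RDual.ind B Y) (by
      rintro _ ⟨η, rfl⟩
      -- Extending `η ∘ f` to `A ⊗_B Y` gives the extension of `η` composed with `A ⊗_B f`.
      refine (Submodule.Quotient.mk_eq_zero _).2 ⟨RDual.ind B M η, Ind.hom_ext_left fun y => ?_⟩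
      change RDual.ind B M η (Ind.map f (Ind.tmul B 1 y)) = _
      rw [Ind.map_tmul]
      rfl)) ∘ₗ (Submodule.Quotient.restrictScalarsEquiv k _).symm.toLinearMap

theorem RDual.cokerInd_mk (f : Y →ₗ[B] M) (φ : RDual B Y) :
    RDual.cokerInd f (Submodule.Quotient.mk φ) = Submodule.Quotient.mk (RDual.ind B Y φ) := rfl

theorem RDual.cokerInd_op_smul (f : Y →ₗ[B] M) (b : B)
    (t : RDual B Y ⧸ LinearMap.range (rdualMap f)) :
    RDual.cokerInd f (op b • t) = op (b : A) • RDual.cokerInd f t := by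
  obtain ⟨φ, rfl⟩ := Submodule.Quotient.mk_surjective _ t
  rw [← Submodule.Quotient.mk_smul, RDual.cokerInd_mk, RDual.cokerInd_mk, RDual.ind_op_smul,
    Submodule.Quotient.mk_smul]

/-- If the extension of `φ` equals `η ∘ (A ⊗_B f)`, then `φ = RDual.res hA η ∘ f`. The witness `η`
need not be homogeneous, since `RDual.res` projects its values to `B`. -/
theorem RDual.cokerInd_injective (hA : IsStronglyGraded 𝒜 B) (f : Y →ₗ[B] M)
    (t : RDual B Y ⧸ LinearMap.range (rdualMap f)) (ht : RDual.cokerInd f t = 0) : t = 0 := by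
  obtain ⟨φ, rfl⟩ := Submodule.Quotient.mk_surjective _ t
  rw [RDual.cokerInd_mk, Submodule.Quotient.mk_eq_zero] at ht
  obtain ⟨η, hη⟩ := ht
  refine (Submodule.Quotient.mk_eq_zero _).2 ⟨RDual.res hA η, ?_⟩
  rw [← RDual.res_ind hA φ, ← hη]
  refine LinearMap.ext fun y => ?_
  change hA.toBase (η (Ind.tmul B 1 (f y))) = hA.toBase (η (Ind.map f (Ind.tmul B 1 y)))
  rw [Ind.map_tmul]

/-- `Coker(f^*) ⊗_B A ≅ Coker((A ⊗_B f)^*)`. -/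
theorem rind_coker_iso [Finite G] (hA : IsStronglyGraded 𝒜 B) (f : Y →ₗ[B] M) :
    GradedIsoRight 𝒜 (rindGrading B 𝒜 (RDual B Y ⧸ LinearMap.range (rdualMap f)))
      (fun g => (rdualGrading 𝒜 (indGrading B 𝒜 Y) g).map
        ((LinearMap.range (rdualMap (Ind.map f))).mkQ.restrictScalars k)) := by
  have hgr := ((hA.ind M).rdual hA).coker ((hA.ind Y).rdual hA) (rdualMap (Ind.map f))
    fun g φ hφ => rdualMap_mem (fun g x hx => Ind.map_mem f g hx) g hφ
  refine .of_degree_one hA (hA.rind _) hgr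
    (RInd.liftHom (RDual.cokerInd f) (RDual.cokerInd_op_smul f)) ?_ ?_ ?_
  · intro g x hx
    refine RInd.map_mem_of_tmul (φ := (RInd.liftHom (RDual.cokerInd f)
      (RDual.cokerInd_op_smul f)).restrictScalars k) (fun a ha t => ?_) hx
    obtain ⟨φ, rfl⟩ := Submodule.Quotient.mk_surjective _ t
    have := hgr.smul_mem g 1 a (RDual.cokerInd f (Submodule.Quotient.mk φ)) ha
      ⟨_, RDual.ind_mem hA φ, rfl⟩
    rwa [one_mul] at this
  · intro x hx h0
    obtain ⟨t, rfl⟩ := RInd.eq_tmul_one hA hx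
    rw [RInd.liftHom_tmul, op_one, one_smul] at h0
    rw [RDual.cokerInd_injective hA f t h0, RInd.zero_tmul]
  · rintro z hz
    obtain ⟨ψ, hψ, rfl⟩ := hz
    refine ⟨RInd.tmul B (Submodule.Quotient.mk (RDual.res hA ψ)) 1, ?_⟩
    rw [RInd.liftHom_tmul, op_one, one_smul, RDual.cokerInd_mk, RDual.ind_res hA hψ]
    rfl

end RDualInd

/-! ### Induction preserves kernels, superfluous submodules, projectivity and finiteness. -/

section Superfluous

theorem IsSuperfluous.bot {R : Type*} [Ring R] {M : Type*} [AddCommGroup M] [Module R M] :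
    IsSuperfluous (⊥ : Submodule R M) := fun N hN => by rwa [sup_bot_eq] at hN

theorem IsSuperfluous.sup {R : Type*} [Ring R] {M : Type*} [AddCommGroup M] [Module R M]
    {K K' : Submodule R M} (h : IsSuperfluous K) (h' : IsSuperfluous K') :
    IsSuperfluous (K ⊔ K') := fun N hN => h N (h' _ (by rwa [sup_assoc]))

variable {k : Type*} [Field k] {G : Type*} [Group G] {A : Type*} [Ring A] [Algebra k A]
  {𝒜 : G → Submodule k A} {B : Subalgebra k A}
  {Y : Type*} [AddCommGroup Y] [Module k Y] [Module B Y] [IsScalarTower k B Y]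
  {M : Type*} [AddCommGroup M] [Module k M] [Module B M] [IsScalarTower k B M]

/-- The `A`-submodule of `A ⊗_B Y` generated by `1 ⊗ K`. -/
def Ind.ofSubmodule (K : Submodule B Y) : Submodule A (Ind B Y) :=
  Submodule.span A (Ind.tmul B 1 '' (K : Set Y))

/-- `A ⊗_B -` preserves kernels. -/
theorem Ind.ker_map [Finite G] (hA : IsStronglyGraded 𝒜 B) (q : Y →ₗ[B] M) :
    LinearMap.ker (Ind.map q) = Ind.ofSubmodule (LinearMap.ker q) := by
  refine le_antisymm ?_ ?_
  · intro x hx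
    rw [LinearMap.mem_ker] at hx
    cases nonempty_fintype G
    rw [← (hA.ind Y).decomp.sum_proj x]
    refine Submodule.sum_mem _ fun g _ => ?_
    -- The kernel of a degree-preserving map is homogeneous, which reduces the claim to one degree.
    have h0 : Ind.map q ((hA.ind Y).decomp.proj g x) = 0 := by
      have := (hA.ind Y).decomp.map_proj (hA.ind M).decomp (φ := (Ind.map q).restrictScalars k)
        (fun g x hx => Ind.map_mem q g hx) g x
      rw [LinearMap.restrictScalars_apply, LinearMap.restrictScalars_apply, hx, map_zero] at this
      exact this
    have hmem := (hA.ind Y).decomp.proj_mem g x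
    generalize (hA.ind Y).decomp.proj g x = z at h0 hmem
    refine hA.mem_of_smul g (Ind.ofSubmodule (LinearMap.ker q)).toAddSubmonoid z fun a _ b hb => ?_
    refine Submodule.smul_mem _ a ?_
    -- In degree `1` the kernel is visible: `b z = 1 ⊗ y`, and `1 ⊗ q y = 0` forces `q y = 0`.
    obtain ⟨y, hy⟩ := Ind.eq_one_tmul hA (x := b • z)
      (by simpa using (hA.ind Y).smul_mem _ _ _ _ hb hmem)
    rw [hy]
    refine Submodule.subset_span ⟨y, ?_, rfl⟩
    refine Ind.one_tmul_injective hA ?_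
    rw [← Ind.map_tmul, ← hy, map_smul, h0, smul_zero, Ind.tmul_zero]
  · rw [Ind.ofSubmodule, Submodule.span_le]
    rintro _ ⟨y, hy, rfl⟩
    change Ind.map q _ = 0
    rw [Ind.map_tmul, LinearMap.mem_ker.1 hy, Ind.tmul_zero]

/-- The `B`-submodule `A_g ⊗ K` of `A ⊗_B Y`. -/
def Ind.component (𝒜 : G → Submodule k A) (K : Submodule B Y) (g : G) : Submodule B (Ind B Y) :=
  Submodule.span B {t | ∃ a ∈ 𝒜 g, ∃ y ∈ K, t = Ind.tmul B a y}

/-- The operation `A_g ⊗ -` is undone by multiplication with `A_{g⁻¹}`. Given `N + A_g ⊗ K = ⊤`, let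
`N'` consist of the `y` with `A_g ⊗ y ⊆ N`. Multiplying by `A_{g⁻¹}` shows `N' + K = Y`, so `N' =
Y`; then `A_g ⊗ K ⊆ N`, and `N` is everything. -/
theorem Ind.component_superfluous (hA : IsStronglyGraded 𝒜 B) {K : Submodule B Y}
    (hK : IsSuperfluous K) (g : G) : IsSuperfluous (Ind.component 𝒜 K g) := by
  intro N hN
  have hsmul : ∀ (b : B) (x : Ind B Y), b • x = (b : A) • x := fun _ _ => rfl
  let N' : Submodule B Y :=
    { carrier := {y | ∀ a ∈ 𝒜 g, Ind.tmul B a y ∈ N}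
      add_mem' := fun hx hy a ha => by rw [Ind.tmul_add]; exact N.add_mem (hx a ha) (hy a ha)
      zero_mem' := fun a _ => by rw [Ind.tmul_zero]; exact N.zero_mem
      smul_mem' := fun b y hy a ha => by
        rw [Ind.tmul_smul]
        exact hy _ (by simpa using hA.mul_mem ha (hA.mem_one b)) }
  let S : AddSubmonoid (Ind B Y) :=
    (N' ⊔ K).toAddSubmonoid.map (Ind.mk B Y 1).toAddMonoidHom
  have hS : ∀ {y}, y ∈ N' ⊔ K → Ind.tmul B 1 y ∈ S := fun hy => ⟨_, hy, rfl⟩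
  have hcomp : ∀ w ∈ Ind.component 𝒜 K g,
      w ∈ indGrading B 𝒜 Y g ∧ ∀ b ∈ 𝒜 g⁻¹, b • w ∈ S := by
    intro w hw
    refine Submodule.span_induction (p := fun w _ =>
      w ∈ indGrading B 𝒜 Y g ∧ ∀ b ∈ 𝒜 g⁻¹, b • w ∈ S) ?_ ?_ ?_ ?_ hw
    · rintro _ ⟨a, ha, y, hy, rfl⟩
      refine ⟨Ind.tmul_mem ha y, fun b hb => ?_⟩
      have hba : b * a ∈ B := hA.mem_one_iff.1 (by simpa using hA.mul_mem hb ha)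
      rw [Ind.smul_tmul, ← one_mul (b * a), ← Ind.tmul_smul 1 ⟨b * a, hba⟩ y]
      exact hS (Submodule.mem_sup_right (K.smul_mem _ hy))
    · exact ⟨zero_mem _, fun b _ => by rw [smul_zero]; exact S.zero_mem⟩
    · rintro x y _ _ ⟨hx, hx'⟩ ⟨hy, hy'⟩
      exact ⟨add_mem hx hy, fun b hb => by rw [smul_add]; exact S.add_mem (hx' b hb) (hy' b hb)⟩
    · rintro c x _ ⟨hx, hx'⟩
      refine ⟨?_, fun b hb => ?_⟩
      · rw [hsmul]
        simpa using (hA.ind Y).smul_mem _ _ _ _ (hA.mem_one c) hx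
      rw [hsmul, smul_smul]
      exact hx' _ (by simpa using hA.mul_mem hb (hA.mem_one c))
  have htop : N' ⊔ K = ⊤ := by
    rw [eq_top_iff]
    rintro y -
    suffices h : Ind.tmul B 1 y ∈ S by
      obtain ⟨y', hy', h⟩ := h
      rwa [← Ind.one_tmul_injective hA h]
    refine hA.mem_of_smul g⁻¹ S _ fun b hb a ha => ?_
    rw [inv_inv] at ha
    -- Split `a ⊗ y = n + w`. Although `N` need not be graded, `n` is a difference of two elements
    -- of degree `g`, so `b n` has degree `1` and is of the form `1 ⊗ y'`; here `y' ∈ N'` because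
    -- `A_g A_{g⁻¹} ⊆ B`.
    obtain ⟨n, hn, w, hw, hnw⟩ := Submodule.mem_sup.1
      (hN ▸ Submodule.mem_top : a • Ind.tmul B 1 y ∈ N ⊔ Ind.component 𝒜 K g)
    rw [← hnw, smul_add]
    refine S.add_mem ?_ ((hcomp w hw).2 b hb)
    have hng : n ∈ indGrading B 𝒜 Y g := by
      rw [eq_sub_of_add_eq hnw, Ind.smul_one_tmul]
      exact sub_mem (Ind.tmul_mem ha y) (hcomp w hw).1
    obtain ⟨y', hy'⟩ := Ind.eq_one_tmul hA (x := b • n)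
      (by simpa using (hA.ind Y).smul_mem _ _ _ _ hb hng)
    rw [hy']
    refine hS (Submodule.mem_sup_left fun c hc => ?_)
    rw [← Ind.smul_one_tmul, ← hy', smul_smul]
    exact N.smul_mem ⟨c * b, hA.mem_one_iff.1 (by simpa using hA.mul_mem hc hb)⟩ hn
  have hN' : N' = ⊤ := hK N' htop
  rw [← hN, eq_comm, sup_eq_left, Ind.component, Submodule.span_le]
  rintro _ ⟨a, ha, y, -, rfl⟩
  exact (hN' ▸ Submodule.mem_top : y ∈ N') a ha

/-- The submodule lies in the sum of the finitely many `A_g ⊗ K`, and a finite sum of superfluous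
submodules is superfluous. It is enough to test over `B`, as every `A`-submodule is a `B`-submodule.
-/
theorem Ind.ofSubmodule_superfluous [Finite G] (hA : IsStronglyGraded 𝒜 B) {K : Submodule B Y}
    (hK : IsSuperfluous K) : IsSuperfluous (Ind.ofSubmodule (A := A) K) := by
  cases nonempty_fintype G
  intro N hN
  have hsup : IsSuperfluous (Finset.univ.sup (Ind.component 𝒜 K)) :=
    Finset.sup_induction .bot (fun _ h _ h' => h.sup h') fun g _ =>
      Ind.component_superfluous hA hK g
  have hle : ∀ z ∈ Ind.ofSubmodule (A := A) K, z ∈ Finset.univ.sup (Ind.component 𝒜 K) := by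
    intro z hz
    have key : ∀ a : A, a • z ∈ Finset.univ.sup (Ind.component 𝒜 K) := by
      refine Submodule.span_induction
        (p := fun z _ => ∀ a : A, a • z ∈ Finset.univ.sup (Ind.component 𝒜 K)) ?_ ?_ ?_ ?_ hz
      · rintro _ ⟨y, hy, rfl⟩ a
        refine hA.decomp.induction
          (C := fun a => a • Ind.tmul B 1 y ∈ Finset.univ.sup (Ind.component 𝒜 K)) ?_ ?_ ?_ a
        · intro g a ha
          rw [Ind.smul_one_tmul]
          exact Finset.le_sup (f := Ind.component 𝒜 K) (Finset.mem_univ g)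
            (Submodule.subset_span ⟨a, ha, y, hy, rfl⟩)
        · rw [zero_smul]; exact zero_mem _
        · intro a b ha hb
          rw [add_smul]; exact add_mem ha hb
      · intro a
        rw [smul_zero]; exact zero_mem _
      · intro x y _ _ hx hy a
        rw [smul_add]; exact add_mem (hx a) (hy a)
      · intro c x _ hx a
        rw [smul_smul]; exact hx _
    simpa using key 1
  have := hsup (N.restrictScalars B) (by
    rw [eq_top_iff]
    rintro z -
    obtain ⟨n, hn, w, hw, rfl⟩ := Submodule.mem_sup.1
      (hN ▸ Submodule.mem_top : z ∈ N ⊔ Ind.ofSubmodule K)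
    exact add_mem (Submodule.mem_sup_left hn) (Submodule.mem_sup_right (hle w hw)))
  rwa [Submodule.restrictScalars_eq_top_iff] at this

/-- Induction is left adjoint to restriction: `y ↦ 1 ⊗ y` lifts over `B` through a given surjection
onto `A ⊗_B Y`, and the `A`-linear extension of the lift is a section. -/
theorem Ind.projective [Module.Projective B Y] : Module.Projective A (Ind B Y) := by
  refine Module.Projective.of_lifting_property'' fun s hs => ?_
  let i : Y →ₗ[B] Ind B Y :=
    { toFun := Ind.tmul B 1
      map_add' := Ind.tmul_add 1
      map_smul' := fun b y => by
        rw [Ind.tmul_smul, one_mul, ← Ind.smul_one_tmul]; rfl }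
  obtain ⟨h, hh⟩ := Module.projective_lifting_property (s.restrictScalars B) i hs
  have hsmul : ∀ (b : B) (y : Y), h.restrictScalars k (b • y) = (b : A) • h.restrictScalars k y :=
    fun b y => map_smul h b y
  refine ⟨Ind.liftHom (h.restrictScalars k) hsmul,
    Ind.hom_ext_left (k := k) fun y => ?_⟩
  rw [LinearMap.comp_apply, Ind.liftHom_tmul, one_smul, LinearMap.id_apply]
  exact LinearMap.congr_fun hh y

omit [IsScalarTower k B Y] in
theorem Ind.finite [Module.Finite B Y] : Module.Finite A (Ind B Y) := by
  obtain ⟨s, hs⟩ := (Module.Finite.fg_top : (⊤ : Submodule B Y).FG)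
  classical
  refine ⟨⟨s.image (Ind.tmul B 1), ?_⟩⟩
  set S := Submodule.span A ((s.image (Ind.tmul B (1 : A)) : Finset (Ind B Y)) : Set (Ind B Y))
  have hone : ∀ y : Y, Ind.tmul B 1 y ∈ S := by
    intro y
    have hy : y ∈ Submodule.span B (s : Set Y) := hs ▸ Submodule.mem_top
    refine Submodule.span_induction (p := fun y _ => Ind.tmul B (1 : A) y ∈ S) ?_ ?_ ?_ ?_ hy
    · intro y hy
      exact Submodule.subset_span (by simpa using ⟨y, hy, rfl⟩)
    · rw [Ind.tmul_zero]; exact zero_mem _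
    · intro x y _ _ hx hy
      rw [Ind.tmul_add]; exact add_mem hx hy
    · intro b y _ hy
      rw [Ind.tmul_smul, one_mul, ← Ind.smul_one_tmul]
      exact S.smul_mem _ hy
  have : S.restrictScalars k = ⊤ := by
    rw [eq_top_iff, ← Ind.span_tmul, Submodule.span_le]
    rintro _ ⟨a, y, rfl⟩
    rw [← Ind.smul_one_tmul]
    exact S.smul_mem a (hone y)
  rwa [Submodule.restrictScalars_eq_top_iff] at this

end Superfluous

/-! ### The induced minimal projective presentation. -/

section Presentations

variable {k : Type*} [Field k] {G : Type*} [Group G] {A : Type u} [Ring A] [Algebra k A]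
  {𝒜 : G → Submodule k A} {B : Subalgebra k A}
  {Y : Type v} [AddCommGroup Y] [Module k Y] [Module B Y] [IsScalarTower k B Y]

/-- The minimal projective presentation of `A ⊗_B Y` induced by one of `Y`. -/
noncomputable def MinProjPres.ind [Finite G] (hA : IsStronglyGraded 𝒜 B)
    (P : MinProjPres.{w} k B Y) : MinProjPres.{max u w} k A (Ind B Y) where
  P₁ := Ind B P.P₁
  P₀ := Ind B P.P₀
  finite₁ := have := P.finite₁; Ind.finite
  finite₀ := have := P.finite₀; Ind.finite
  projective₁ := have := P.projective₁; Ind.projective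
  projective₀ := have := P.projective₀; Ind.projective
  f := Ind.map P.f
  p := Ind.map P.p
  surjective := by
    rw [← LinearMap.range_eq_top, ← Submodule.restrictScalars_eq_top_iff k, eq_top_iff,
      ← Ind.span_tmul, Submodule.span_le]
    rintro _ ⟨a, y, rfl⟩
    obtain ⟨x, rfl⟩ := P.surjective y
    exact ⟨Ind.tmul B a x, Ind.map_tmul _ _ _⟩
  exact := by
    refine le_antisymm ?_ ?_
    · rw [LinearMap.range_le_ker_iff]
      refine Ind.hom_ext_left fun y => ?_
      have : P.p (P.f y) = 0 := (P.exact ▸ LinearMap.mem_range_self P.f y : P.f y ∈ P.p.ker)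
      rw [LinearMap.comp_apply, Ind.map_tmul, Ind.map_tmul, this, Ind.tmul_zero,
        LinearMap.zero_apply]
    · rw [Ind.ker_map hA, ← P.exact, Ind.ofSubmodule, Submodule.span_le]
      rintro _ ⟨_, ⟨x, rfl⟩, rfl⟩
      exact ⟨Ind.tmul B 1 x, Ind.map_tmul _ _ _⟩
  minimal₀ := by
    rw [Ind.ker_map hA]
    exact Ind.ofSubmodule_superfluous hA P.minimal₀
  minimal₁ := by
    rw [Ind.ker_map hA]
    exact Ind.ofSubmodule_superfluous hA P.minimal₁

theorem MinProjPres.ind_isGraded [Finite G] (hA : IsStronglyGraded 𝒜 B)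
    (P : MinProjPres.{w} k B Y) : (P.ind hA).IsGraded 𝒜 (indGrading B 𝒜 Y)
      (indGrading B 𝒜 P.P₁) (indGrading B 𝒜 P.P₀) where
  graded₁ := hA.ind _
  graded₀ := hA.ind _
  map_f g _ hx := Ind.map_mem P.f g hx
  map_p g _ hx := Ind.map_mem P.p g hx

theorem MinProjPres.ind_tr_iso [Finite G] (hA : IsStronglyGraded 𝒜 B)
    (P : MinProjPres.{w} k B Y) :
    GradedIsoRight 𝒜 ((P.ind hA).trGrading 𝒜 (indGrading B 𝒜 P.P₁)) (rindGrading B 𝒜 P.Tr) :=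
  (rind_coker_iso hA P.f).symm

end Presentations


/-! ### Uniqueness of minimal projective presentations, plain and graded. -/

section Uniqueness

variable {R : Type*} [Ring R] {P P' M : Type*} [AddCommGroup P] [Module R P] [AddCommGroup P']
  [Module R P'] [AddCommGroup M] [Module R M]

/-- Equality of the images of `q` and `q'` gives `range u + ker q' = P'`. -/
theorem IsSuperfluous.surjective {q : P →ₗ[R] M} {q' : P' →ₗ[R] M}
    (hq : LinearMap.range q = LinearMap.range q') (h' : IsSuperfluous (LinearMap.ker q'))
    (u : P →ₗ[R] P') (hu : q' ∘ₗ u = q) : Function.Surjective u := by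
  rw [← LinearMap.range_eq_top]
  refine h' _ ?_
  rw [eq_top_iff]
  rintro x -
  obtain ⟨y, hy⟩ := (hq ▸ LinearMap.mem_range_self q' x : q' x ∈ LinearMap.range q)
  rw [← add_sub_cancel (u y) x]
  refine add_mem (Submodule.mem_sup_left ⟨y, rfl⟩) (Submodule.mem_sup_right ?_)
  rw [LinearMap.mem_ker, map_sub, ← hy, ← hu, LinearMap.comp_apply, sub_self]

/-- Maps between two projective covers of the same submodule are bijective. -/
theorem IsSuperfluous.bijective [Module.Projective R P'] {q : P →ₗ[R] M} {q' : P' →ₗ[R] M}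
    (hq : LinearMap.range q = LinearMap.range q') (h : IsSuperfluous (LinearMap.ker q))
    (h' : IsSuperfluous (LinearMap.ker q')) (u : P →ₗ[R] P') (hu : q' ∘ₗ u = q) :
    Function.Bijective u := by
  have hu' : Function.Surjective u := IsSuperfluous.surjective hq h' u hu
  -- A section `s` of `u` is again a map over `M`, so it is surjective by the same lemma with the
  -- roles exchanged; a surjective section makes `u` injective.
  obtain ⟨s, hs⟩ := Module.projective_lifting_property u LinearMap.id hu'
  have hqs : q ∘ₗ s = q' := by rw [← hu, LinearMap.comp_assoc, hs, LinearMap.comp_id]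
  have hs' : Function.Surjective s := IsSuperfluous.surjective hq.symm h s hqs
  refine ⟨?_, hu'⟩
  have : Function.LeftInverse u s := fun x => LinearMap.congr_fun hs x
  exact (this.rightInverse_of_surjective hs').injective

/-- Comparing ranges instead of asking `q'` to be surjective lets this serve both `P₀ → X` and `P₁ →
P₀`. -/
theorem exists_lift [Module.Projective R P] {q : P →ₗ[R] M} {q' : P' →ₗ[R] M}
    (hq : LinearMap.range q ≤ LinearMap.range q') : ∃ u : P →ₗ[R] P', q' ∘ₗ u = q := by
  obtain ⟨u, hu⟩ := Module.projective_lifting_property q'.rangeRestrict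
    (q.codRestrict (LinearMap.range q') fun x => hq ⟨x, rfl⟩) q'.surjective_rangeRestrict
  exact ⟨u, LinearMap.ext fun x => congrArg Subtype.val (LinearMap.congr_fun hu x)⟩

/-- Degree-preserving maps lift to degree-preserving maps. -/
theorem exists_graded_lift {k : Type*} [Field k] {G : Type*} [Group G] [Finite G] [Algebra k R]
    {𝒜 : G → Submodule k R} (hA : IsDecomp 𝒜)
    [Module k P] [Module k P'] [Module k M] [IsScalarTower k R P] [IsScalarTower k R P']
    [IsScalarTower k R M] {𝒲 : G → Submodule k P} {𝒲' : G → Submodule k P'}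
    {ℳ : G → Submodule k M} (hP : IsGradedLeft 𝒜 𝒲) (hP' : IsGradedLeft 𝒜 𝒲')
    (hM : IsGradedLeft 𝒜 ℳ) [Module.Projective R P] {q : P →ₗ[R] M} {q' : P' →ₗ[R] M}
    (hqd : ∀ g, ∀ x ∈ 𝒲 g, q x ∈ ℳ g) (hqd' : ∀ g, ∀ x ∈ 𝒲' g, q' x ∈ ℳ g)
    (hq : LinearMap.range q ≤ LinearMap.range q') :
    ∃ u : P →ₗ[R] P', q' ∘ₗ u = q ∧ ∀ g, ∀ x ∈ 𝒲 g, u x ∈ 𝒲' g := by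
  cases nonempty_fintype G
  obtain ⟨u, hu⟩ := exists_lift hq
  -- The degree-`1` component of any lift is still a lift, because `q` and `q'` preserve degrees.
  refine ⟨homComponent hA hP hP' 1 u, LinearMap.restrictScalars_injective k
    (hP.decomp.hom_ext fun g x hx => ?_), fun g x hx => ?_⟩
  · change q' (homComponent hA hP hP' 1 u x) = q x
    rw [homComponent_apply_of_mem _ _ _ _ _ hx, mul_one]
    refine (hP'.decomp.map_proj hM.decomp (φ := q'.restrictScalars k) hqd' g (u x)).trans ?_
    have : q' (u x) = q x := LinearMap.congr_fun hu x
    rw [LinearMap.restrictScalars_apply, this]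
    exact hM.decomp.proj_self (hqd g x hx)
  · rw [homComponent_apply_of_mem _ _ _ _ _ hx, mul_one]
    exact hP'.decomp.proj_mem _ _

/-- Precomposition with an isomorphism. -/
def rdualEquiv (e : P ≃ₗ[R] P') : RDual R P' ≃ₗ[Rᵐᵒᵖ] RDual R P where
  __ := rdualMap e.toLinearMap
  invFun φ := φ.comp e.symm.toLinearMap
  left_inv φ := LinearMap.ext fun x => congrArg φ (e.apply_symm_apply x)
  right_inv φ := LinearMap.ext fun x => congrArg φ (e.symm_apply_apply x)

end Uniqueness

namespace MinProjPres

section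

variable {k : Type*} [Field k] {R : Type*} [Ring R] [Algebra k R] {X : Type*} [AddCommGroup X]
  [Module R X]

/-- The isomorphism of transposes induced by an isomorphism of presentations. -/
def trEquiv (P : MinProjPres.{w₁} k R X) (Q : MinProjPres.{w₂} k R X)
    (u₁ : P.P₁ ≃ₗ[R] Q.P₁) (u₀ : P.P₀ ≃ₗ[R] Q.P₀) (h : ∀ x, Q.f (u₁ x) = u₀ (P.f x)) :
    Q.Tr ≃ₗ[Rᵐᵒᵖ] P.Tr :=
  Submodule.Quotient.equiv _ _ (rdualEquiv u₁) (by
    ext φ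
    constructor
    · rintro ⟨_, ⟨η, rfl⟩, rfl⟩
      exact ⟨rdualEquiv u₀ η, LinearMap.ext fun x => congrArg η (h x).symm⟩
    · rintro ⟨η, rfl⟩
      refine ⟨_, ⟨rdualEquiv u₀.symm η, rfl⟩, LinearMap.ext fun x => ?_⟩
      change η (u₀.symm (Q.f (u₁ x))) = η (P.f x)
      rw [h, u₀.symm_apply_apply])

theorem trEquiv_mk (P : MinProjPres.{w₁} k R X) (Q : MinProjPres.{w₂} k R X)
    (u₁ : P.P₁ ≃ₗ[R] Q.P₁) (u₀ : P.P₀ ≃ₗ[R] Q.P₀) (h : ∀ x, Q.f (u₁ x) = u₀ (P.f x))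
    (φ : RDual R Q.P₁) :
    trEquiv P Q u₁ u₀ h (Submodule.Quotient.mk φ) = Submodule.Quotient.mk (rdualEquiv u₁ φ) := rfl

/-- The isomorphism `u₀` carries `ker P.p` onto `ker Q.p`. So `u₀ ∘ P.f` and `Q.f` cover the same
submodule, and the comparison of covers applies a second time. -/
theorem range_comp (P : MinProjPres.{w₁} k R X) (Q : MinProjPres.{w₂} k R X)
    (u₀ : P.P₀ →ₗ[R] Q.P₀) (hu : Function.Bijective u₀) (h : Q.p ∘ₗ u₀ = P.p) :
    LinearMap.range (u₀ ∘ₗ P.f) = LinearMap.range Q.f := by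
  rw [LinearMap.range_comp, P.exact, Q.exact, ← h, LinearMap.ker_comp,
    Submodule.map_comap_eq_of_surjective hu.2]

theorem superfluous_comp (P : MinProjPres.{w₁} k R X) {M : Type*} [AddCommGroup M] [Module R M]
    (u₀ : P.P₀ →ₗ[R] M) (hu : Function.Bijective u₀) :
    IsSuperfluous (LinearMap.ker (u₀ ∘ₗ P.f)) := by
  rw [LinearMap.ker_comp_of_ker_eq_bot _ (LinearMap.ker_eq_bot.2 hu.1)]
  exact P.minimal₁

theorem range_p_eq (P : MinProjPres.{w₁} k R X) (Q : MinProjPres.{w₂} k R X) :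
    LinearMap.range P.p = LinearMap.range Q.p := by
  rw [LinearMap.range_eq_top.2 P.surjective, LinearMap.range_eq_top.2 Q.surjective]

/-- Minimal projective presentations are unique up to isomorphism. -/
theorem exists_equiv (P : MinProjPres.{w₁} k R X) (Q : MinProjPres.{w₂} k R X) :
    ∃ (u₁ : P.P₁ ≃ₗ[R] Q.P₁) (u₀ : P.P₀ ≃ₗ[R] Q.P₀), ∀ x, Q.f (u₁ x) = u₀ (P.f x) := by
  have := P.projective₀
  have := P.projective₁
  have := Q.projective₀
  have := Q.projective₁
  obtain ⟨u₀, h₀⟩ := exists_lift (range_p_eq P Q).le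
  have hb₀ := IsSuperfluous.bijective (range_p_eq P Q) P.minimal₀ Q.minimal₀ u₀ h₀
  have hr := range_comp P Q u₀ hb₀ h₀
  obtain ⟨u₁, h₁⟩ := exists_lift hr.le
  have hb₁ := IsSuperfluous.bijective hr (superfluous_comp P u₀ hb₀) Q.minimal₁ u₁ h₁
  exact ⟨.ofBijective u₁ hb₁, .ofBijective u₀ hb₀, fun x => LinearMap.congr_fun h₁ x⟩

/-- Graded minimal projective presentations are unique up to degree-preserving isomorphism. -/
theorem exists_graded_equiv {G : Type*} [Group G] [Finite G] {𝒜 : G → Submodule k R}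
    (hA : IsDecomp 𝒜) [Module k X] [IsScalarTower k R X] {𝒳 : G → Submodule k X}
    (hX : IsGradedLeft 𝒜 𝒳) (P : MinProjPres.{w₁} k R X) (Q : MinProjPres.{w₂} k R X)
    {𝒫₁ : G → Submodule k P.P₁} {𝒫₀ : G → Submodule k P.P₀} (hP : P.IsGraded 𝒜 𝒳 𝒫₁ 𝒫₀)
    {𝒬₁ : G → Submodule k Q.P₁} {𝒬₀ : G → Submodule k Q.P₀} (hQ : Q.IsGraded 𝒜 𝒳 𝒬₁ 𝒬₀) :
    ∃ (u₁ : P.P₁ ≃ₗ[R] Q.P₁) (u₀ : P.P₀ ≃ₗ[R] Q.P₀), (∀ x, Q.f (u₁ x) = u₀ (P.f x)) ∧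
      ∀ g x, x ∈ 𝒫₁ g ↔ u₁ x ∈ 𝒬₁ g := by
  have := P.projective₀
  have := P.projective₁
  have := Q.projective₀
  have := Q.projective₁
  obtain ⟨u₀, h₀, hd₀⟩ := exists_graded_lift hA hP.graded₀ hQ.graded₀ hX hP.map_p hQ.map_p
    (range_p_eq P Q).le
  have hb₀ := IsSuperfluous.bijective (range_p_eq P Q) P.minimal₀ Q.minimal₀ u₀ h₀
  have hr := range_comp P Q u₀ hb₀ h₀
  obtain ⟨u₁, h₁, hd₁⟩ := exists_graded_lift hA hP.graded₁ hQ.graded₁ hQ.graded₀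
    (q := u₀ ∘ₗ P.f) (fun g x hx => hd₀ g _ (hP.map_f g x hx)) hQ.map_f hr.le
  have hb₁ := IsSuperfluous.bijective hr (superfluous_comp P u₀ hb₀) Q.minimal₁ u₁ h₁
  refine ⟨.ofBijective u₁ hb₁, .ofBijective u₀ hb₀, fun x => LinearMap.congr_fun h₁ x,
    fun g x => ⟨hd₁ g x, fun hx => ?_⟩⟩
  rw [hP.graded₁.decomp.mem_iff]
  refine hb₁.1 ?_
  refine (hP.graded₁.decomp.map_proj hQ.graded₁.decomp (φ := u₁.restrictScalars k) hd₁ g x).trans ?_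
  exact hQ.graded₁.decomp.proj_self hx

end

section

variable {k : Type*} [Field k] {G : Type*} [Group G] [Finite G] {A : Type u} [Ring A] [Algebra k A]
  {𝒜 : G → Submodule k A} {B : Subalgebra k A}
  {Y : Type v} [AddCommGroup Y] [Module k Y] [Module B Y] [IsScalarTower k B Y]

omit [Finite G] in
theorem trGrading_mem_iff {X : Type*} [AddCommGroup X] [Module A X]
    (P : MinProjPres.{w₁} k A X) (Q : MinProjPres.{w₂} k A X)
    {𝒫₁ : G → Submodule k P.P₁} {𝒬₁ : G → Submodule k Q.P₁} (u₁ : P.P₁ ≃ₗ[A] Q.P₁)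
    (u₀ : P.P₀ ≃ₗ[A] Q.P₀) (h : ∀ x, Q.f (u₁ x) = u₀ (P.f x))
    (hu : ∀ g x, x ∈ 𝒫₁ g ↔ u₁ x ∈ 𝒬₁ g) (g : G) (t : Q.Tr) :
    t ∈ Q.trGrading 𝒜 𝒬₁ g ↔ trEquiv P Q u₁ u₀ h t ∈ P.trGrading 𝒜 𝒫₁ g := by
  constructor
  · rintro ⟨φ, hφ, rfl⟩
    exact ⟨rdualEquiv u₁ φ, fun j x hx => hφ j _ ((hu j x).1 hx), rfl⟩
  · rintro ⟨ψ, hψ, hψt⟩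
    refine ⟨(rdualEquiv u₁).symm ψ, fun j x hx => hψ j _ ((hu j _).2 ?_), ?_⟩
    · change u₁ (u₁.symm x) ∈ _
      rwa [u₁.apply_symm_apply]
    · refine (trEquiv P Q u₁ u₀ h).injective ?_
      rw [← hψt]
      change trEquiv P Q u₁ u₀ h (Submodule.Quotient.mk ((rdualEquiv u₁).symm ψ)) = _
      rw [trEquiv_mk, LinearEquiv.apply_symm_apply]
      rfl

/-- The transpose is known for the induced presentation `P.ind hA`; uniqueness carries it over to
`Q`. -/
theorem tr_iso (hA : IsStronglyGraded 𝒜 B) (P : MinProjPres.{w₁} k B Y)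
    (Q : MinProjPres.{w₂} k A (Ind B Y)) : Nonempty (Q.Tr ≃ₗ[Aᵐᵒᵖ] RInd B P.Tr) := by
  obtain ⟨u₁, u₀, h⟩ := exists_equiv (P.ind hA) Q
  obtain ⟨-, -, e, -⟩ := P.ind_tr_iso hA
  exact ⟨(trEquiv _ _ u₁ u₀ h).trans e⟩

theorem tau_iso (hA : IsStronglyGraded 𝒜 B) (P : MinProjPres.{w₁} k B Y)
    (Q : MinProjPres.{w₂} k A (Ind B Y)) : Nonempty (Q.tau ≃ₗ[A] Ind B P.tau) := by
  obtain ⟨e⟩ := tr_iso hA P Q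
  obtain ⟨-, -, e', -⟩ := ind_kdual_iso hA P.Tr
  exact ⟨(e'.trans (kdualEquiv e)).symm⟩

theorem graded_tr_iso (hA : IsStronglyGraded 𝒜 B) (P : MinProjPres.{w₁} k B Y)
    (Q : MinProjPres.{w₂} k A (Ind B Y)) {𝒬₁ : G → Submodule k Q.P₁} {𝒬₀ : G → Submodule k Q.P₀}
    (hQ : Q.IsGraded 𝒜 (indGrading B 𝒜 Y) 𝒬₁ 𝒬₀) :
    GradedIsoRight 𝒜 (Q.trGrading 𝒜 𝒬₁) (rindGrading B 𝒜 P.Tr) := by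
  obtain ⟨u₁, u₀, h, hu⟩ :=
    exists_graded_equiv hA.decomp (hA.ind Y) (P.ind hA) Q (P.ind_isGraded hA) hQ
  refine GradedIsoRight.trans ⟨?_, (P.ind_tr_iso hA).1, trEquiv _ _ u₁ u₀ h,
    trGrading_mem_iff _ _ u₁ u₀ h hu⟩ (P.ind_tr_iso hA)
  exact (hQ.graded₀.rdual hA).coker (hQ.graded₁.rdual hA) (rdualMap Q.f)
    fun g φ hφ => rdualMap_mem hQ.map_f g hφ

theorem graded_tau_iso (hA : IsStronglyGraded 𝒜 B) (P : MinProjPres.{w₁} k B Y)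
    (Q : MinProjPres.{w₂} k A (Ind B Y)) {𝒬₁ : G → Submodule k Q.P₁} {𝒬₀ : G → Submodule k Q.P₀}
    (hQ : Q.IsGraded 𝒜 (indGrading B 𝒜 Y) 𝒬₁ 𝒬₀) :
    GradedIsoLeft 𝒜 (dualGrading (Q.trGrading 𝒜 𝒬₁)) (indGrading B 𝒜 P.tau) := by
  have h : GradedIsoLeft 𝒜 (dualGrading (Q.trGrading 𝒜 𝒬₁))
      (dualGrading (rindGrading B 𝒜 P.Tr)) := (graded_tr_iso hA P Q hQ).dual
  have h' : GradedIsoLeft 𝒜 (indGrading B 𝒜 P.tau) (dualGrading (rindGrading B 𝒜 P.Tr)) :=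
    ind_kdual_iso hA P.Tr
  exact h.trans h'.symm

end

end MinProjPres

/-! ### Existence of minimal projective presentations over Artinian rings. -/

section Existence

/-- A finitely generated projective module mapping onto `Y` has a direct summand that is a
projective cover of `Y`. -/
theorem exists_projective_cover {R : Type*} [Ring R] [IsArtinianRing R] {Y : Type*}
    [AddCommGroup Y] [Module R Y] {F : Type*} [AddCommGroup F] [Module R F] [Module.Finite R F]
    [Module.Projective R F] (p : F →ₗ[R] Y) (hp : Function.Surjective p) :
    ∃ S : Submodule R F, Module.Projective R S ∧ Function.Surjective (p.domRestrict S) ∧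
      IsSuperfluous (LinearMap.ker (p.domRestrict S)) := by
  have : IsNoetherianRing R := inferInstance
  have : IsNoetherian R F := inferInstance
  have : IsArtinian R F := inferInstance
  let C : Set (Submodule R F) :=
    {S | Module.Projective R S ∧ Function.Surjective (p.domRestrict S)}
  have hC : C.Nonempty := by
    refine ⟨⊤, .of_equiv (Submodule.topEquiv (R := R) (M := F)).symm, fun y => ?_⟩
    obtain ⟨x, rfl⟩ := hp y
    exact ⟨⟨x, trivial⟩, rfl⟩
  -- `S` is minimal among the projective submodules of `F` that still map onto `Y`.
  obtain ⟨S, ⟨hSp, hSs⟩, hmin⟩ := WellFounded.has_min (wellFounded_lt (α := Submodule R F)) C hC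
  refine ⟨S, hSp, hSs, fun N hN => ?_⟩
  set q := p.domRestrict S with hq
  have hqN : Function.Surjective (q.domRestrict N) := by
    intro y
    obtain ⟨x, rfl⟩ := hSs y
    obtain ⟨n, hn, c, hc, rfl⟩ := Submodule.mem_sup.1 (hN ▸ Submodule.mem_top : x ∈ N ⊔ q.ker)
    refine ⟨⟨n, hn⟩, ?_⟩
    rw [map_add, LinearMap.mem_ker.1 hc, add_zero]
    rfl
  -- Lifting `q` through `N` gives an endomorphism `φ` of `S` over `Y` with image inside `N`.
  obtain ⟨u, hu⟩ := Module.projective_lifting_property (q.domRestrict N) q hqN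
  let φ : Module.End R S := N.subtype ∘ₗ u
  have hφ : ∀ x, q (φ x) = q x := fun x => LinearMap.congr_fun hu x
  have hφn : ∀ n x, q ((φ ^ n) x) = q x := by
    intro n
    induction n with
    | zero => intro x; rfl
    | succ n ih => intro x; rw [pow_succ', Module.End.mul_apply, hφ, ih]
  -- Fitting's lemma: for large `n` the range of `φ ^ n` is a direct summand of `S`, so it is
  -- projective. It maps onto `Y`, and by minimality it is all of `S`. The bound `1 ≤ n` is what
  -- puts this range inside `N`.
  obtain ⟨n, hn0, hn⟩ := ((Filter.eventually_ge_atTop 1).and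
    φ.eventually_isCompl_ker_pow_range_pow).exists
  set T := LinearMap.range (φ ^ n)
  have hTp : Module.Projective R T :=
    .of_split T.subtype (Submodule.projectionOnto _ _ hn.symm)
      (Submodule.projectionOnto_comp_subtype hn.symm)
  have hTC : T.map S.subtype ∈ C := by
    refine ⟨.of_equiv (Submodule.equivMapOfInjective S.subtype S.injective_subtype T), fun y => ?_⟩
    obtain ⟨x, rfl⟩ := hSs y
    exact ⟨⟨(φ ^ n) x, Submodule.mem_map_of_mem ⟨x, rfl⟩⟩, hφn n x⟩
  have hT : T.map S.subtype = S := by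
    by_contra hne
    exact hmin _ hTC (lt_of_le_of_ne (Submodule.map_subtype_le S T) hne)
  have hTtop : T = ⊤ := by
    refine Submodule.map_injective_of_injective S.injective_subtype ?_
    rw [hT, Submodule.map_top, Submodule.range_subtype]
  rw [eq_top_iff, ← hTtop]
  rintro _ ⟨x, rfl⟩
  obtain ⟨m, rfl⟩ : ∃ m, n = m + 1 := ⟨n - 1, by omega⟩
  rw [pow_succ', Module.End.mul_apply]
  exact (u _).2

/-- An Artinian ring is Noetherian, so the kernel of a first cover is finitely generated and can be
covered in turn. -/
theorem exists_minProjPres {k : Type*} [Field k] {R : Type u} [Ring R] [Algebra k R]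
    [IsArtinianRing R] (Y : Type v) [AddCommGroup Y] [Module R Y] [Module.Finite R Y] :
    Nonempty (MinProjPres.{u} k R Y) := by
  have : IsNoetherianRing R := inferInstance
  obtain ⟨n, p, hp⟩ := Module.Finite.exists_fin' R Y
  obtain ⟨S, hS, hSs, hSm⟩ := exists_projective_cover p hp
  obtain ⟨m, q, hq⟩ : ∃ (m : ℕ) (q : (Fin m → R) →ₗ[R] LinearMap.ker (p.domRestrict S)),
      Function.Surjective q := Module.Finite.exists_fin' R (LinearMap.ker (p.domRestrict S))
  obtain ⟨T, hT, hTs, hTm⟩ := exists_projective_cover (R := R) (Y := LinearMap.ker (p.domRestrict S))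
    (F := Fin m → R) q hq
  have hker := LinearMap.ker_comp_of_ker_eq_bot (q.domRestrict T)
    (Submodule.ker_subtype (LinearMap.ker (p.domRestrict S)))
  exact ⟨{
    P₁ := T
    P₀ := S
    finite₁ := inferInstance
    finite₀ := inferInstance
    projective₁ := hT
    projective₀ := hS
    f := (LinearMap.ker (p.domRestrict S)).subtype ∘ₗ q.domRestrict T
    p := p.domRestrict S
    surjective := hSs
    exact := by
      rw [LinearMap.range_comp, LinearMap.range_eq_top.2 hTs, Submodule.map_top,
        Submodule.range_subtype]
    minimal₀ := hSm
    minimal₁ := by rw [hker]; exact hTm }⟩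

end Existence

/-- A strongly graded algebra of finite dimension is zero or has a finite grading group. -/
theorem IsStronglyGraded.subsingleton_or_finite {k : Type*} [Field k] {G : Type*} [Group G]
    {A : Type*} [Ring A] [Algebra k A] [Module.Finite k A] {𝒜 : G → Submodule k A}
    {B : Subalgebra k A} (hA : IsStronglyGraded 𝒜 B) : Subsingleton A ∨ Finite G := by
  cases subsingleton_or_nontrivial A with
  | inl h => exact .inl h
  | inr h =>
    -- An independent family of nonzero subspaces of a finite dimensional space is finite, and `A_g
    -- = 0` would give `1 ∈ A_g A_{g⁻¹} = 0`.
    refine .inr (WellFoundedGT.finite_of_iSupIndep hA.indep fun g hg => ?_)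
    have h1 := hA.mul_eq g g⁻¹
    rw [hg, Submodule.bot_mul, mul_inv_cancel] at h1
    have h2 := hA.one_mem
    rw [← h1, Submodule.mem_bot] at h2
    exact one_ne_zero h2

end StronglyGradedInd

open StronglyGradedInd in
theorem proposition3p5 {k : Type*} [Field k] {G : Type*} [Group G]
    {A : Type u} [Ring A] [Algebra k A] [Module.Finite k A]
    (𝒜 : G → Submodule k A) (B : Subalgebra k A) (hA : IsStronglyGraded 𝒜 B)
    (Y : Type v) [AddCommGroup Y] [Module k Y] [Module B Y] [IsScalarTower k B Y]
    [Module.Finite B Y] :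
    -- `D(A ⊗_B Y) ≅ DY ⊗_B A`
    GradedIsoRight 𝒜 (dualGrading (indGrading B 𝒜 Y)) (rindGrading B 𝒜 (KDual k Y)) ∧
    -- `Hom_A(A ⊗_B Y, A) ≅ Hom_B(Y, B) ⊗_B A`
    GradedIsoRight 𝒜 (rdualGrading 𝒜 (indGrading B 𝒜 Y)) (rindGrading B 𝒜 (RDual B Y)) ∧
    -- `ν_A(A ⊗_B Y) ≅ A ⊗_B ν_B(Y)`
    GradedIsoLeft 𝒜 (dualGrading (rdualGrading 𝒜 (indGrading B 𝒜 Y)))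
      (indGrading B 𝒜 (Nakayama k B Y)) ∧
    (Module.Injective B B →
      -- minimal projective presentations of `Y`, and graded ones of `A ⊗_B Y`, exist
      Nonempty (MinProjPres.{u} k B Y) ∧
      (∃ (Q : MinProjPres.{u} k A (Ind B Y)) (𝒬₁ : G → Submodule k Q.P₁)
        (𝒬₀ : G → Submodule k Q.P₀), Q.IsGraded 𝒜 (indGrading B 𝒜 Y) 𝒬₁ 𝒬₀) ∧
      ∀ (P : MinProjPres.{w₁} k B Y) (Q : MinProjPres.{w₂} k A (Ind B Y)),
        -- `Tr_A(A ⊗_B Y) ≅ Tr_B Y ⊗_B A` and `τ_A(A ⊗_B Y) ≅ A ⊗_B τ_B Y`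
        Nonempty (Q.Tr ≃ₗ[Aᵐᵒᵖ] RInd B P.Tr) ∧
        Nonempty (Q.tau ≃ₗ[A] Ind B P.tau) ∧
        -- the same as graded modules
        ∀ (𝒬₁ : G → Submodule k Q.P₁) (𝒬₀ : G → Submodule k Q.P₀),
          Q.IsGraded 𝒜 (indGrading B 𝒜 Y) 𝒬₁ 𝒬₀ →
          GradedIsoRight 𝒜 (Q.trGrading 𝒜 𝒬₁) (rindGrading B 𝒜 P.Tr) ∧
          GradedIsoLeft 𝒜 (dualGrading (Q.trGrading 𝒜 𝒬₁)) (indGrading B 𝒜 P.tau)) := by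
  have : IsArtinianRing A := .of_finite k A
  have : IsArtinianRing B := .of_finite k B
  -- Over the zero algebra `G` may be infinite, but all `A`-modules vanish and each isomorphism is
  -- the zero map.
  obtain hs | hG := hA.subsingleton_or_finite
  · refine ⟨.of_subsingleton _ _, .of_subsingleton _ _, .of_subsingleton _ _, fun _ =>
      ⟨exists_minProjPres Y, ?_, fun P Q => ⟨?_, ?_, fun _ _ _ =>
        ⟨.of_subsingleton _ _, .of_subsingleton _ _⟩⟩⟩⟩
    · have : Module.Finite A (Ind B Y) := Ind.finite
      obtain ⟨Q⟩ := exists_minProjPres (k := k) (R := A) (Ind B Y)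
      have := Module.subsingleton A Q.P₁
      have := Module.subsingleton A Q.P₀
      have := Module.subsingleton A (Ind B Y)
      refine ⟨Q, fun _ => ⊥, fun _ => ⊥, .of_subsingleton _, .of_subsingleton _,
        fun g x _ => ?_, fun g x _ => ?_⟩
      · rw [Subsingleton.elim (Q.f x) 0]; exact zero_mem _
      · rw [Subsingleton.elim (Q.p x) 0]; exact zero_mem _
    · have := Module.subsingleton Aᵐᵒᵖ Q.Tr
      have := Module.subsingleton Aᵐᵒᵖ (RInd B P.Tr)
      exact ⟨0⟩
    · have := Module.subsingleton A Q.tau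
      have := Module.subsingleton A (Ind B P.tau)
      exact ⟨0⟩
  -- The Nakayama statement is the dual of the second isomorphism, composed with `D(N ⊗_B A) ≅ A ⊗_B
  -- DN` for `N = Hom_B(Y, B)`.
  · refine ⟨(rind_kdual_iso hA Y).symm, (rind_rdual_iso hA Y).symm,
      (rind_rdual_iso hA Y).symm.dual.trans (ind_kdual_iso hA _).symm, fun _ =>
      ⟨exists_minProjPres Y, ?_, fun P Q => ⟨P.tr_iso hA Q, P.tau_iso hA Q, fun 𝒬₁ 𝒬₀ hQ => ?_⟩⟩⟩
    · obtain ⟨P⟩ := exists_minProjPres (k := k) (R := B) Y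
      exact ⟨P.ind hA, _, _, P.ind_isGraded hA⟩
    · exact ⟨P.graded_tr_iso hA Q hQ, P.graded_tau_iso hA Q hQ⟩
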